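/- **Setting.** Let $N\ge 2$ and let $\mathcal G$ be a directed graph on the agents $1,\dots,N$; $\mathcal N_i$ is the set of agents $j$ with an edge from $j$ to $i$ ($i$ obtains information from $j$), $N_i=|\mathcal N_i|$, $\bar N=\max_i N_i$. Assume that $\mathcal G$ has a directed spanning tree with root $r$, i.e. $r$ has directed paths to all other agents. Let $a_{ij}=1$ if $j\in\mathcal N_i$ and $a_{ij}=0$ otherwise, $\mathcal L$ the Laplacian ($\mathcal L_{ij}=\delta_{ij}\sum_k a_{ik}-a_{ij}$), $\mathcal L_r$ the matrix $\mathcal L$ without row and column $r$, and $M=\mathcal L_r+1\alpha^{T}$ with $\alpha=(a_{rj})_{j\ne r}$ (so $M=\mathcal L_r$ if $r$ has no neighbours). Let $L$ be the larger of the spectral norms of $M$ and of $\mathcal L$ without column $r$ (so $L=\|\mathcal L_r\|$ if $r$ has no neighbours). The agents $\dot x_i=u_i$, $x_i(t)\in\mathbb R^n$, use $u_i(t)=-\sum_{j\in\mathcal N_i}\big(x_i(t_{k_i})-x_{ji}(t)\big)$, where $t_{k_i}$ is the latest event of agent $i$ up to time $t$ and $x_{ji}(t)$ is the most recently broadcast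 state of agent $j$ among those that have arrived at $i$ by time $t$. Each agent broadcasts its state at its events, the first of which is at $t=0$; the broadcasts at time $0$ arrive at once. After event $k_i$ of agent $i$ the next one is at $$t_{k_i+1}=\min\{t>t_{k_i} : \|x_i(t_{k_i})-x_i(t)\|=\beta e^{-\lambda t}\ \text{ or }\ t=t_{k_i}+\bar\delta\}.$$ On each edge from $i$ to $j$ broadcasts may be dropped, at most $\rho-1$ successively ($\rho>1$), and broadcast $k_i$, if not dropped, arrives with a delay $d_{ij}(t_{k_i})\ge 0$; drops and delays may differ between receivers. **Constants.** Let $\beta,\gamma_d,\bar\delta>0$; let $\hat\beta,\hat\lambda>0$ satisfy $\|e^{-Mt}\|\le\hat\beta e^{-\hat\lambda t}$ for all $t\ge0$, and let $0<\lambda<\hat\lambda$. Let $\eta_0=\big(\sum_i\|x_i(0)-x_r(0)\|^2\big)^{1/2}$ and, for a number $\tau_0\ge 0$, $$\gamma=\gamma_d+\beta e^{\rho\lambda\bar\delta}\sum_{\mu=1}^{\rho}e^{-\mu\lambda\tau_0},\qquad \Gamma=\bar N\sqrt N\,\beta+\gamma\Big(\sum_i N_i^2\Big)^{1/2}+\sqrt{N-1}\,N_r(\beta+\gamma),$$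 $$H_1=L\hat\beta\Big(\eta_0-\frac{\Gamma}{\hat\lambda-\lambda}\Big),\qquad H_2^{i}=N_i(\beta+\gamma)+\frac{L\hat\beta\,\Gamma}{\hat\lambda-\lambda},$$ $$d_i(t)=\frac1{\hat\lambda}\ln\Big(1+\frac{\gamma_d}{\frac{H_2^i}{\lambda}+\frac{H_1}{\hat\lambda}e^{(\lambda-\hat\lambda)t}}\Big),\qquad \tau_i(t)=\frac1{\hat\lambda}\ln\Big(1+\frac{\beta}{\frac{H_2^i}{\lambda}+\frac{H_1}{\hat\lambda}e^{(\lambda-\hat\lambda)t}}\Big).$$ Here $\tau_0$ is a lower bound for the inter-event times in the sense that for all $i,k_i$ one has $\tau_0\le t_{k_i+1}-t_{k_i}$ or $\tau_0\le\min\{\bar\delta,\tau_i(t_{k_i})\}$; $\tau_0=0$ is always allowed. **Theorem.** Such $\hat\beta,\hat\lambda$ exist. If every broadcast that is not dropped satisfies $d_{ij}(t_{k_i})\le d_i(t_{k_i})$, then: 1. the agents reach consensus: $\|x_i(t)-x_j(t)\|\to0$ as $t\to\infty$ for all $i,j$; 2. there is no Zeno behavior: the event times of every agent tend to infinity; 3.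 $\tau_i(t_{k_i})>0$ and $t_{k_i+1}-t_{k_i}\ge\min\{\bar\delta,\tau_i(t_{k_i})\}$ for all $i,k_i$ (so $t_{k_i+1}-t_{k_i}\ge\tau_i(t_{k_i})$ whenever $\tau_i(t_{k_i})\le\bar\delta$), and there is one $c>0$ with $t_{k_i+1}-t_{k_i}\ge c$ for all $i,k_i$. -/

import Mathlib

open Filter Topology

namespace EventConsensus

/-- The set `N_i` of neighbours of agent `i`: the agents whose information agent `i` can obtain.
An edge `j → i` of the digraph means that `i` obtains information from `j`. -/
noncomputable def nbrs {N : ℕ} (G : Digraph (Fin N)) (i : Fin N) : Finset (Fin N) :=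
  open Classical in Finset.univ.filter fun j => G.Adj j i

/-- The number `N_i` of neighbours of agent `i`. -/
noncomputable def deg {N : ℕ} (G : Digraph (Fin N)) (i : Fin N) : ℕ := (nbrs G i).card

/-- `r` is the root of a directed spanning tree: it has directed paths to all other agents. -/
def IsRoot {N : ℕ} (G : Digraph (Fin N)) (r : Fin N) : Prop :=
  ∀ i, Relation.ReflTransGen G.Adj r i

/-- The adjacency matrix: `a_ij = 1` if there is an edge `j → i`, and `0` otherwise. -/
noncomputable def adjacency {N : ℕ} (G : Digraph (Fin N)) : Matrix (Fin N) (Fin N) ℝ :=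
  open Classical in Matrix.of fun i j => if G.Adj j i then 1 else 0

/-- The Laplacian `D - A`. -/
noncomputable def laplacian {N : ℕ} (G : Digraph (Fin N)) : Matrix (Fin N) (Fin N) ℝ :=
  Matrix.diagonal (fun i => ∑ j ∈ nbrs G i, adjacency G i j) - adjacency G

/-- The Laplacian with the row and the column of `r` deleted. -/
noncomputable def groundedLaplacian {N : ℕ} (G : Digraph (Fin N)) (r : Fin N) :
    Matrix {i : Fin N // i ≠ r} {i : Fin N // i ≠ r} ℝ :=
  (laplacian G).submatrix Subtype.val Subtype.val

/-- The matrix `M = L_r + 1 αᵀ`, `α_j = a_rj`, which governs the disagreements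
`η_i = x_i - x_r` (`η' = -M η + …`). It is `L_r` itself when `r` has no neighbours. -/
noncomputable def reducedLaplacian {N : ℕ} (G : Digraph (Fin N)) (r : Fin N) :
    Matrix {i : Fin N // i ≠ r} {i : Fin N // i ≠ r} ℝ :=
  groundedLaplacian G r + Matrix.of fun _ j => adjacency G r j.val

/-- The Laplacian with the column of `r` deleted; it maps the disagreements `η` to the
velocities (up to sign and errors) of all agents, `r` included. -/
noncomputable def velocityMatrix {N : ℕ} (G : Digraph (Fin N)) (r : Fin N) :
    Matrix (Fin N) {i : Fin N // i ≠ r} ℝ :=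
  (laplacian G).submatrix id Subtype.val

/-- The spectral norm of a matrix (the operator norm for Euclidean norms). -/
noncomputable def specNorm {m k : Type} [Fintype m] [Fintype k] [DecidableEq k]
    (A : Matrix m k ℝ) : ℝ :=
  open scoped Matrix.Norms.L2Operator in ‖A‖

/-- `b, l > 0` and `‖exp (-M s)‖ ≤ b * exp (-l s)` for all `s ≥ 0`. -/
def IsDecayPair {N : ℕ} (G : Digraph (Fin N)) (r : Fin N) (b l : ℝ) : Prop :=
  0 < b ∧ 0 < l ∧ ∀ s : ℝ, 0 ≤ s →
    specNorm (NormedSpace.exp (-(s • reducedLaplacian G r))) ≤ b * Real.exp (-(l * s))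

/-- The scalar parameters of the protocol and of its analysis. -/
structure Params where
  /-- threshold amplitude `β` -/
  beta : ℝ
  /-- threshold decay rate `λ` -/
  lam : ℝ
  /-- `β̂` of the matrix exponential bound -/
  betaHat : ℝ
  /-- `λ̂` of the matrix exponential bound -/
  lamHat : ℝ
  /-- `γ_d`, the share of the error that is granted to the delays -/
  gammaD : ℝ
  /-- `δ̄`, the maximum inter-event time -/
  deltaBar : ℝ
  /-- `τ₀ ≥ 0`, the a priori lower bound on inter-event times that enters `γ_l`;
  `τ₀ = 0` is always possible -/
  tau0 : ℝ
  /-- at most `ρ - 1` successive dropouts -/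
  rho : ℕ

namespace Params

/-- `γ_l = β exp(ρ λ δ̄) ∑_{μ=1}^ρ exp(-μ λ τ₀)`. -/
noncomputable def gammaL (p : Params) : ℝ :=
  p.beta * Real.exp (p.rho * p.lam * p.deltaBar) *
    ∑ m ∈ Finset.Icc 1 p.rho, Real.exp (-(m * p.lam * p.tau0))

/-- `γ = γ_l + γ_d`. -/
noncomputable def gamma (p : Params) : ℝ := p.gammaL + p.gammaD

/-- `Γ = (max_i N_i) √N β + γ (∑ N_i²)^{1/2} + √(N-1) N_r (β + γ)`. The last summand bounds the
disturbance of the root's own input; it vanishes when the root has no neighbours. -/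
noncomputable def Gam (p : Params) {N : ℕ} (G : Digraph (Fin N)) (r : Fin N) : ℝ :=
  (Finset.univ.sup (deg G) : ℕ) * √(N : ℝ) * p.beta
    + p.gamma * √(∑ i, (deg G i : ℝ) ^ 2)
    + √((N : ℝ) - 1) * (deg G r : ℝ) * (p.beta + p.gamma)

end Params

/-- `L`: the larger of the spectral norms of the two matrices; it is `‖L_r‖` when the root has no
neighbours. -/
noncomputable def gainL {N : ℕ} (G : Digraph (Fin N)) (r : Fin N) : ℝ :=
  max (specNorm (reducedLaplacian G r)) (specNorm (velocityMatrix G r))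

/-- `η₀ = ‖η(0)‖`, the Euclidean norm of all initial disagreements with the root. -/
noncomputable def eta0 {N n : ℕ} (r : Fin N) (x0 : Fin N → EuclideanSpace ℝ (Fin n)) : ℝ :=
  √(∑ i, ‖x0 i - x0 r‖ ^ 2)

/-- `H₁ = L β̂ (η₀ - Γ / (λ̂ - λ))`. -/
noncomputable def H1 (p : Params) {N n : ℕ} (G : Digraph (Fin N)) (r : Fin N)
    (x0 : Fin N → EuclideanSpace ℝ (Fin n)) : ℝ :=
  gainL G r * p.betaHat * (eta0 r x0 - p.Gam G r / (p.lamHat - p.lam))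

/-- `H₂ = N_i (β + γ) + L β̂ Γ / (λ̂ - λ)`, for agent `i`. -/
noncomputable def H2 (p : Params) {N : ℕ} (G : Digraph (Fin N)) (r i : Fin N) : ℝ :=
  (deg G i : ℝ) * (p.beta + p.gamma)
    + gainL G r * p.betaHat * p.Gam G r / (p.lamHat - p.lam)

/-- `(1/λ̂) ln (1 + c / (H₂/λ + (H₁/λ̂) exp((λ-λ̂) s)))`, for agent `i`. -/
noncomputable def horizon (p : Params) {N n : ℕ} (G : Digraph (Fin N)) (r : Fin N)
    (x0 : Fin N → EuclideanSpace ℝ (Fin n)) (c : ℝ) (i : Fin N) (s : ℝ) : ℝ :=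
  1 / p.lamHat * Real.log (1 + c /
    (H2 p G r i / p.lam + H1 p G r x0 / p.lamHat * Real.exp ((p.lam - p.lamHat) * s)))

/-- The admissible delay `d` of a measurement that agent `i` broadcasts at time `s`. -/
noncomputable def delayBound (p : Params) {N n : ℕ} (G : Digraph (Fin N)) (r : Fin N)
    (x0 : Fin N → EuclideanSpace ℝ (Fin n)) (i : Fin N) (s : ℝ) : ℝ :=
  horizon p G r x0 p.gammaD i s

/-- The lower bound `τ` on the time from an event of agent `i` at time `s` to its next event. -/
noncomputable def tau (p : Params) {N n : ℕ} (G : Digraph (Fin N)) (r : Fin N)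
    (x0 : Fin N → EuclideanSpace ℝ (Fin n)) (i : Fin N) (s : ℝ) : ℝ :=
  horizon p G r x0 p.beta i s

/-- The data of a run of the network: states, event times, and the behaviour of the channels. -/
structure Run (N n : ℕ) where
  /-- `x i s`: the state of agent `i` at time `s` -/
  x : Fin N → ℝ → EuclideanSpace ℝ (Fin n)
  /-- `t i k`: the time of the `k`-th event (broadcast) of agent `i` -/
  t : Fin N → ℕ → ℝ
  /-- `recv i j k`: the `k`-th broadcast of `i` is not dropped on its way to `j` -/
  recv : Fin N → Fin N → ℕ → Prop
  /-- `delay i j k`: the delay of the `k`-th broadcast of `i` on its way to `j` -/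
  delay : Fin N → Fin N → ℕ → ℝ

namespace Run

variable {N n : ℕ}

/-- Time `s` lies before every accumulation point of events. The closed loop is only defined up
to such a point; that there is none has to be proved. -/
def Before (R : Run N n) (s : ℝ) : Prop := ∀ i, ∃ k, s < R.t i k

/-- The index of the latest event of agent `i` up to time `s`. -/
noncomputable def lastEvent (R : Run N n) (i : Fin N) (s : ℝ) : ℕ :=
  sSup {k | R.t i k ≤ s}

/-- The index of the latest broadcast of `i` among those that have arrived at `j` by time `s`. -/
noncomputable def lastRecv (R : Run N n) (i j : Fin N) (s : ℝ) : ℕ :=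
  sSup {k | R.recv i j k ∧ R.t i k + R.delay i j k ≤ s}

/-- `x_ij`: the state of agent `i` as seen by agent `j`. -/
noncomputable def seen (R : Run N n) (i j : Fin N) (s : ℝ) : EuclideanSpace ℝ (Fin n) :=
  R.x i (R.t i (R.lastRecv i j s))

/-- `u_i = -∑_{j ∈ N_i} (x_i(t_{k_i}) - x_ji)`. -/
noncomputable def control (R : Run N n) (G : Digraph (Fin N)) (i : Fin N) (s : ℝ) :
    EuclideanSpace ℝ (Fin n) :=
  -∑ j ∈ nbrs G i, (R.x i (R.t i (R.lastEvent i s)) - R.seen j i s)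

/-- The run is one of the event-triggered protocol over the unreliable network. -/
structure IsExecution (R : Run N n) (G : Digraph (Fin N)) (p : Params) : Prop where
  first_event : ∀ i, R.t i 0 = 0
  /-- the next event occurs when the local error meets the threshold or `δ̄` has elapsed -/
  next_event : ∀ i k, IsLeast {s | R.t i k < s ∧
    (‖R.x i (R.t i k) - R.x i s‖ = p.beta * Real.exp (-(p.lam * s)) ∨
      s = R.t i k + p.deltaBar)} (R.t i (k + 1))
  /-- the neighbours' initial states are available at time `0` -/
  first_recv : ∀ i j, G.Adj i j → R.recv i j 0 ∧ R.delay i j 0 = 0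
  /-- at most `ρ - 1` successive dropouts after a successful transmission -/
  dropouts : ∀ i j, G.Adj i j → ∀ k, R.recv i j k →
    ∃ m, 1 ≤ m ∧ m ≤ p.rho ∧ R.recv i j (k + m)
  delay_nonneg : ∀ i j, G.Adj i j → ∀ k, 0 ≤ R.delay i j k
  continuous : ∀ i, ContinuousOn (R.x i) {s | 0 ≤ s ∧ R.Before s}
  /-- `x_i' = u_i`; the input is piecewise constant and continuous from the right, so that the
  derivative is the one from the right -/
  dynamics : ∀ i s, 0 ≤ s → R.Before s →
    HasDerivWithinAt (R.x i) (R.control G i s) (Set.Ici s) s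

/-- The initial states. -/
def init (R : Run N n) : Fin N → EuclideanSpace ℝ (Fin n) := fun i => R.x i 0

/-- Asymptotic consensus. -/
def Consensus (R : Run N n) : Prop :=
  ∀ i j, Tendsto (fun s => ‖R.x i s - R.x j s‖) atTop (𝓝 0)

/-- No agent generates infinitely many events in finite time. -/
def NoZeno (R : Run N n) : Prop := ∀ i, Tendsto (R.t i) atTop atTop

end Run

end EventConsensus

/-! The proof is a bootstrap on `Accurate`: every agent sees its neighbours with error below `γ exp
(-λ s)`. While this holds, each input is the exact Laplacian feedback plus a disturbance of order
`exp (-λ s)`. Variation of constants for `η' = -M η + …` (`sqrt_sum_disagreement_sq_le`) then makes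
the disagreements decay and bounds the speed of agent `i` by `H₁ exp (-λ̂ s) + H₂ exp (-λ s)`. The
integral of this bound limits the distance travelled, and `tau` and `delayBound` are the times for
which that distance stays within the shares `β` and `γ_d`.

Two things follow. Inter-event times are at least `min δ̄ τ` (`min_tau_le`). Accuracy on `[0, T)`
extends to `T` with strict inequality (`accurate_of_accurate_before`), because dropouts cost at most
`γ_l` and a broadcast in flight at most `γ_d`. Strict inequality persists to the right, so accuracy
cannot fail before an accumulation of events (`accurate`). A first accumulation contradicts the
uniform lower bound on `τ` (`before`). Consensus is then the decay of `η`.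

The delicate point is that the tolerance shrinks by `exp (-λ d)` during a delay `d`, so `γ_d` must
pay for the travel and also for the relative growth of `γ_l`. `travel_strict` shows that it can,
provided `λ λ̂ γ ≤ L β̂ Γ`. Every decay pair has this property: comparing `det (exp (-s M)) = exp
(-s tr M)` with the decay of the entries bounds `λ̂` by the mean diagonal entry of `M`, hence by the
degrees.

Decay pairs exist because `exp (-ℒ)` is row-stochastic with a positive column `r`, hence contracts
the spread of the states by a fixed factor per unit of time; `disagreementMatrix` carries this over
to `M`. -/

namespace EventConsensus

/-! ### Spectral norm, entries and determinant of the matrix exponential -/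

section MatrixExponential

open scoped Matrix.Norms.L2Operator

variable {m k : Type} [Fintype m] [Fintype k] [DecidableEq k]

theorem specNorm_nonneg (A : Matrix m k ℝ) : 0 ≤ specNorm A := norm_nonneg A

theorem sqrt_sum_sq_mulVec_le (A : Matrix m k ℝ) (v : k → ℝ) :
    √(∑ i, (∑ j, A i j * v j) ^ 2) ≤ specNorm A * √(∑ j, v j ^ 2) := by
  have h := A.l2_opNorm_mulVec (WithLp.toLp 2 v)
  rw [EuclideanSpace.norm_eq, EuclideanSpace.norm_eq] at h
  simpa [specNorm, Matrix.mulVec, dotProduct] using h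

/-- The matrix acts on each of the `n` coordinates separately, so the scalar bound can be summed
over coordinates. -/
theorem sqrt_sum_norm_sq_smul_le {n : ℕ} (A : Matrix m k ℝ) (v : k → EuclideanSpace ℝ (Fin n)) :
    √(∑ i, ‖∑ j, A i j • v j‖ ^ 2) ≤ specNorm A * √(∑ j, ‖v j‖ ^ 2) := by
  have hA := specNorm_nonneg A
  apply Real.sqrt_le_iff.2 ⟨by positivity, ?_⟩
  rw [mul_pow, Real.sq_sqrt (by positivity)]
  simp only [EuclideanSpace.real_norm_sq_eq]
  rw [Finset.sum_comm, Finset.sum_comm (s := (Finset.univ : Finset k)), Finset.mul_sum]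
  refine Finset.sum_le_sum fun c _ => ?_
  have h := sqrt_sum_sq_mulVec_le A fun j => v j c
  rw [Real.sqrt_le_iff, mul_pow, Real.sq_sqrt (by positivity)] at h
  simpa using h.2

theorem norm_sum_smul_le {n : ℕ} (A : Matrix m k ℝ) (v : k → EuclideanSpace ℝ (Fin n)) (i : m) :
    ‖∑ j, A i j • v j‖ ≤ specNorm A * √(∑ j, ‖v j‖ ^ 2) := by
  refine le_trans (Real.le_sqrt_of_sq_le ?_) (sqrt_sum_norm_sq_smul_le A v)
  exact Finset.single_le_sum (f := fun i => ‖∑ j, A i j • v j‖ ^ 2) (fun _ _ => by positivity)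
    (Finset.mem_univ i)

theorem abs_entry_le_specNorm (A : Matrix m k ℝ) (i : m) (j : k) : |A i j| ≤ specNorm A := by
  have h := sqrt_sum_sq_mulVec_le A (Pi.single j 1)
  simp only [Pi.single_apply, mul_ite, mul_one, mul_zero, Finset.sum_ite_eq', Finset.mem_univ,
    if_true, ite_pow, one_pow, ne_eq, OfNat.ofNat_ne_zero, not_false_eq_true, zero_pow,
    Real.sqrt_one] at h
  refine le_trans (Real.abs_le_sqrt ?_) h
  exact Finset.single_le_sum (f := fun i => A i j ^ 2) (fun _ _ => by positivity)
    (Finset.mem_univ i)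

theorem specNorm_le_of_entry_le [DecidableEq m] :
    ∃ C : ℝ, 0 < C ∧ ∀ (A : Matrix m k ℝ) (c : ℝ), 0 ≤ c → (∀ i j, |A i j| ≤ c) →
      specNorm A ≤ C * c := by
  -- The summand `1` keeps the constant positive when an index type is empty.
  refine ⟨1 + ∑ i, ∑ j, ‖Matrix.single (α := ℝ) i j (1 : ℝ) (m := m) (n := k)‖,
    by positivity, fun A c hc h => ?_⟩
  have hA : specNorm A ≤ ∑ i, ∑ j, ‖Matrix.single i j (A i j)‖ := by
    conv_lhs => rw [Matrix.matrix_eq_sum_single A]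
    exact (norm_sum_le _ _).trans (Finset.sum_le_sum fun i _ => norm_sum_le _ _)
  refine hA.trans ?_
  rw [add_mul, Finset.sum_mul]
  simp_rw [Finset.sum_mul]
  refine le_trans ?_ (le_add_of_nonneg_left (by positivity))
  refine Finset.sum_le_sum fun i _ => Finset.sum_le_sum fun j _ => ?_
  have : Matrix.single i j (A i j) = A i j • Matrix.single i j (1 : ℝ) := by
    rw [Matrix.smul_single, smul_eq_mul, mul_one]
  rw [this, norm_smul, Real.norm_eq_abs, mul_comm]
  exact mul_le_mul_of_nonneg_left (h i j) (norm_nonneg _)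

theorem hasDerivAt_exp_smul (A : Matrix k k ℝ) (s : ℝ) :
    HasDerivAt (fun u : ℝ => NormedSpace.exp (u • A)) (NormedSpace.exp (s • A) * A) s :=
  hasDerivAt_exp_smul_const A s

theorem hasDerivAt_exp_smul_entry (A : Matrix k k ℝ) (s : ℝ) (i j : k) :
    HasDerivAt (fun u : ℝ => NormedSpace.exp (u • A) i j) ((NormedSpace.exp (s • A) * A) i j) s := by
  let φ : Matrix k k ℝ →L[ℝ] ℝ := LinearMap.toContinuousLinearMap (Matrix.entryLinearMap ℝ ℝ i j)
  exact φ.hasFDerivAt.comp_hasDerivAt s (hasDerivAt_exp_smul A s)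

theorem differentiable_det : Differentiable ℝ (fun A : Matrix k k ℝ => A.det) := by
  have hφ : ∀ i j : k, Differentiable ℝ (fun A : Matrix k k ℝ => A i j) := fun i j =>
    (LinearMap.toContinuousLinearMap (Matrix.entryLinearMap ℝ ℝ i j)).differentiable
  simp only [Matrix.det_apply']
  refine Differentiable.fun_sum fun σ _ => ?_
  refine Differentiable.const_mul ?_ _
  intro A
  have := HasFDerivAt.finsetProd (u := Finset.univ) (g := fun i (A : Matrix k k ℝ) => A (σ i) i)
    fun i _ => (hφ (σ i) i A).hasFDerivAt
  exact this.differentiableAt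

/-- The derivative depends only on the tangent of the curve at `0`, so `exp (u A)` may be replaced
by `1 + u A`, whose determinant is an explicit polynomial in `u`. -/
theorem hasDerivAt_det_exp_smul_zero (A : Matrix k k ℝ) :
    HasDerivAt (fun u : ℝ => (NormedSpace.exp (u • A)).det) A.trace 0 := by
  have hd := (differentiable_det (k := k) 1).hasFDerivAt
  have h1 : HasDerivAt (fun u : ℝ => NormedSpace.exp (u • A)) A 0 := by
    simpa using hasDerivAt_exp_smul A 0
  have h2 : HasDerivAt (fun u : ℝ => (1 : Matrix k k ℝ) + u • A) A 0 := by
    simpa using ((hasDerivAt_id (0 : ℝ)).smul_const A).const_add 1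
  have h3 := HasFDerivAt.comp_hasDerivAt_of_eq (0 : ℝ) hd h1 (by simp)
  have h4 := HasFDerivAt.comp_hasDerivAt_of_eq (0 : ℝ) hd h2 (by simp)
  have h5 : HasDerivAt (fun u : ℝ => ((1 : Matrix k k ℝ) + u • A).det) A.trace 0 := by
    rw [funext fun u : ℝ => Matrix.det_one_add_smul u A]
    have := ((((hasDerivAt_id (0 : ℝ)).const_mul A.trace).const_add 1).add
      (((Matrix.det (1 + (Polynomial.X : Polynomial ℝ) • A.map Polynomial.C)).divX.divX.hasDerivAt 0).mul
        ((hasDerivAt_id (0 : ℝ)).pow 2)))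
    refine this.congr_deriv ?_
    simp
  have h6 := h4.unique h5
  rw [h6] at h3
  exact h3

theorem exp_add_smul (A : Matrix k k ℝ) (s u : ℝ) :
    NormedSpace.exp ((s + u) • A) = NormedSpace.exp (s • A) * NormedSpace.exp (u • A) := by
  rw [add_smul]
  exact Matrix.exp_add_of_commute _ _ ((Commute.refl A).smul_left s |>.smul_right u)

/-- By the group law and multiplicativity of `det`, the determinant solves `f' = (tr A) f`; the
product with `exp (-u tr A)` is constant. -/
theorem det_exp_smul (A : Matrix k k ℝ) (s : ℝ) :
    (NormedSpace.exp (s • A)).det = Real.exp (s * A.trace) := by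
  have hd : ∀ s : ℝ, HasDerivAt (fun u : ℝ => (NormedSpace.exp (u • A)).det)
      ((NormedSpace.exp (s • A)).det * A.trace) s := by
    intro s
    have h0 : HasDerivAt (fun u : ℝ => (NormedSpace.exp (u • A)).det) A.trace (s - s) := by
      simpa using hasDerivAt_det_exp_smul_zero A
    have h := (h0.comp_sub_const s s).const_mul (NormedSpace.exp (s • A)).det
    refine h.congr_of_eventuallyEq (Eventually.of_forall fun u => ?_)
    simp only
    rw [← Matrix.det_mul, ← exp_add_smul]
    simp
  have hc : ∀ u : ℝ, HasDerivAt
      (fun u : ℝ => (NormedSpace.exp (u • A)).det * Real.exp (-(u * A.trace))) 0 u := by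
    intro u
    have h := (hd u).mul (((hasDerivAt_id u).mul_const A.trace).neg.exp)
    refine h.congr_deriv ?_
    simp only [id]
    ring
  have h := is_const_of_deriv_eq_zero (fun u => (hc u).differentiableAt) (fun u => (hc u).deriv) s 0
  simp only [zero_smul, NormedSpace.exp_zero, Matrix.det_one, zero_mul, neg_zero, Real.exp_zero,
    mul_one, Real.exp_neg] at h
  field_simp at h
  exact h

end MatrixExponential

/-! ### The Laplacian, its reductions, and bounds on the decay rate -/

section Laplacian

variable {N : ℕ} (G : Digraph (Fin N)) (r : Fin N)

theorem mem_nbrs {i j : Fin N} : j ∈ nbrs G i ↔ G.Adj j i := by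
  simp [nbrs]

theorem adjacency_eq_ite (i j : Fin N) :
    adjacency G i j = if j ∈ nbrs G i then 1 else 0 := by
  by_cases h : G.Adj j i <;> simp [adjacency, mem_nbrs, h]

theorem adjacency_nonneg (i j : Fin N) : 0 ≤ adjacency G i j := by
  rw [adjacency_eq_ite]
  split_ifs <;> norm_num

theorem sum_nbrs_adjacency (i : Fin N) : ∑ j ∈ nbrs G i, adjacency G i j = deg G i := by
  rw [Finset.sum_congr rfl fun j hj => by rw [adjacency_eq_ite, if_pos hj]]
  simp [deg]

theorem sum_adjacency_smul {E : Type*} [AddCommGroup E] [Module ℝ E] (i : Fin N) (x : Fin N → E) :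
    ∑ j, adjacency G i j • x j = ∑ j ∈ nbrs G i, x j := by
  simp only [adjacency_eq_ite, ite_smul, one_smul, zero_smul]
  rw [Finset.sum_ite_mem, Finset.univ_inter]

theorem sum_adjacency (i : Fin N) : ∑ j, adjacency G i j = deg G i := by
  have := sum_adjacency_smul G i fun _ => (1 : ℝ)
  simpa [deg] using this

theorem laplacian_apply (i j : Fin N) :
    laplacian G i j = (if i = j then (deg G i : ℝ) else 0) - adjacency G i j := by
  rw [laplacian, Matrix.sub_apply, Matrix.diagonal_apply, sum_nbrs_adjacency]

theorem sum_laplacian_smul {E : Type*} [AddCommGroup E] [Module ℝ E] (i : Fin N) (x : Fin N → E) :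
    ∑ j, laplacian G i j • x j = ∑ j ∈ nbrs G i, (x i - x j) := by
  simp only [laplacian_apply, sub_smul, Finset.sum_sub_distrib, sum_adjacency_smul, ite_smul,
    zero_smul, Finset.sum_ite_eq, Finset.mem_univ, if_true, Finset.sum_const, deg]
  rw [Nat.cast_smul_eq_nsmul]

theorem sum_laplacian (i : Fin N) : ∑ j, laplacian G i j = 0 := by
  simpa using sum_laplacian_smul G i fun _ => (1 : ℝ)

theorem sum_velocityMatrix_smul {E : Type*} [AddCommGroup E] [Module ℝ E] (i : Fin N)
    (x : Fin N → E) :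
    ∑ j : {j : Fin N // j ≠ r}, velocityMatrix G r i j • (x j - x r)
      = ∑ j ∈ nbrs G i, (x i - x j) := by
  have h := Fintype.sum_eq_add_sum_subtype_ne (fun j => laplacian G i j • (x j - x r)) r
  have h2 := sum_laplacian_smul G i fun j => x j - x r
  simp only [sub_sub_sub_cancel_right] at h2
  rw [h2] at h
  simpa [velocityMatrix] using h.symm

theorem reducedLaplacian_apply (i j : {i : Fin N // i ≠ r}) :
    reducedLaplacian G r i j = velocityMatrix G r i j - velocityMatrix G r r j := by
  simp [reducedLaplacian, groundedLaplacian, velocityMatrix, laplacian_apply, j.2.symm]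

/-- The diagonal entries are `deg i - a_ii + a_ri`, and the `a_ri` add up to at most `deg r`. -/
theorem trace_reducedLaplacian_le : (reducedLaplacian G r).trace ≤ ∑ i, (deg G i : ℝ) := by
  rw [Fintype.sum_eq_add_sum_subtype_ne (fun i => (deg G i : ℝ)) r, Matrix.trace,
    ← sum_adjacency G r, Fintype.sum_eq_add_sum_subtype_ne (fun i => adjacency G r i) r,
    add_assoc, ← Finset.sum_add_distrib]
  refine le_trans (Finset.sum_le_sum fun i _ => ?_) (le_add_of_nonneg_left (adjacency_nonneg G r r))
  have := adjacency_nonneg G i i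
  simp only [Matrix.diag_apply, reducedLaplacian, groundedLaplacian, Matrix.add_apply,
    Matrix.submatrix_apply, laplacian_apply, if_true, Matrix.of_apply]
  linarith

theorem card_subtype_ne : Fintype.card {i : Fin N // i ≠ r} = N - 1 := by
  rw [Fintype.card_subtype_compl, Fintype.card_subtype_eq, Fintype.card_fin]

variable {G r}

/-- The entries of `exp (-s M)` are at most `b exp (-l s)`, so its determinant `exp (-s tr M)` is at
most a constant times `exp (-(N-1) l s)`. For large `s` this forces the comparison of the exponents.
-/
theorem IsDecayPair.card_mul_le_trace {b l : ℝ} (h : IsDecayPair G r b l) :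
    ((N - 1 : ℕ) : ℝ) * l ≤ (reducedLaplacian G r).trace := by
  obtain ⟨hb, -, h⟩ := h
  set M := reducedLaplacian G r
  set c := (((N - 1 : ℕ)).factorial : ℝ) * b ^ (N - 1) with hc
  have key : ∀ s : ℝ, 0 ≤ s → s * ((N - 1 : ℕ) * l - M.trace) ≤ c := by
    intro s hs
    have h1 := Matrix.det_le (A := NormedSpace.exp (-(s • M))) (abv := AbsoluteValue.abs)
      (x := b * Real.exp (-(l * s))) fun i j => (abs_entry_le_specNorm _ i j).trans (h s hs)
    rw [← neg_smul, det_exp_smul, card_subtype_ne, nsmul_eq_mul, mul_pow, ← mul_assoc, ← hc,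
      AbsoluteValue.abs_apply, abs_of_pos (Real.exp_pos _), ← Real.exp_nat_mul] at h1
    have h2 : Real.exp (s * ((N - 1 : ℕ) * l - M.trace)) ≤ c := by
      have := mul_le_mul_of_nonneg_right h1 (Real.exp_pos (s * ((N - 1 : ℕ) * l))).le
      rw [mul_assoc, ← Real.exp_add, ← Real.exp_add] at this
      ring_nf at this ⊢
      simpa using this
    linarith [Real.add_one_le_exp (s * ((N - 1 : ℕ) * l - M.trace))]
  by_contra! hlt
  have hc0 : 0 < c := by positivity
  have := key ((c + 1) / ((N - 1 : ℕ) * l - M.trace)) (div_nonneg (by positivity) (by linarith))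
  rw [div_mul_cancel₀ _ (by linarith)] at this
  linarith

theorem IsDecayPair.le_specNorm (hN : 2 ≤ N) {b l : ℝ} (h : IsDecayPair G r b l) :
    l ≤ specNorm (reducedLaplacian G r) := by
  have h1 : (reducedLaplacian G r).trace ≤ ((N - 1 : ℕ) : ℝ) * specNorm (reducedLaplacian G r) := by
    rw [← card_subtype_ne r, Matrix.trace, ← nsmul_eq_mul, ← Finset.card_univ]
    exact Finset.sum_le_card_nsmul _ _ _ fun i _ =>
      (le_abs_self _).trans (abs_entry_le_specNorm _ i i)
  have hpos : (0 : ℝ) < ((N - 1 : ℕ) : ℝ) := by exact_mod_cast (by omega : 0 < N - 1)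
  exact le_of_mul_le_mul_left (h.card_mul_le_trace.trans h1) hpos

theorem IsDecayPair.one_le (hN : 2 ≤ N) {b l : ℝ} (h : IsDecayPair G r b l) : 1 ≤ b := by
  have h0 := h.2.2 0 le_rfl
  obtain ⟨i⟩ : Nonempty {i : Fin N // i ≠ r} := by
    rw [← Fintype.card_pos_iff, card_subtype_ne]
    omega
  have := (abs_entry_le_specNorm _ i i).trans h0
  simpa using this

/-- The rate of decay is bounded in terms of the degrees. -/
theorem IsDecayPair.le_degrees (hN : 2 ≤ N) {b l : ℝ} (h : IsDecayPair G r b l) :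
    l ≤ √(∑ i, (deg G i : ℝ) ^ 2) + √((N : ℝ) - 1) * deg G r := by
  have hN1 : (1 : ℝ) ≤ (N : ℝ) - 1 := by
    have : (2 : ℝ) ≤ N := by exact_mod_cast hN
    linarith
  have h1 := h.card_mul_le_trace.trans (trace_reducedLaplacian_le G r)
  rw [Nat.cast_sub (by omega), Nat.cast_one] at h1
  set q := √((N : ℝ) - 1) with hq
  have hq1 : 1 ≤ q := Real.one_le_sqrt.2 hN1
  have hqq : q ^ 2 = (N : ℝ) - 1 := Real.sq_sqrt (by linarith)
  set Q := √(∑ i, (deg G i : ℝ) ^ 2) with hQ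
  have h2 : ∑ i, (deg G i : ℝ) ≤ q * Q + deg G r := by
    rw [Fintype.sum_eq_add_sum_subtype_ne (fun i => (deg G i : ℝ)) r, add_comm]
    gcongr
    have hcs := sq_sum_le_card_mul_sum_sq (s := Finset.univ)
      (f := fun i : {i : Fin N // i ≠ r} => (deg G i : ℝ))
    rw [Finset.card_univ, card_subtype_ne, Nat.cast_sub (by omega), Nat.cast_one] at hcs
    have hle : ∑ i : {i : Fin N // i ≠ r}, (deg G i : ℝ) ^ 2 ≤ ∑ i, (deg G i : ℝ) ^ 2 := by
      rw [Fintype.sum_eq_add_sum_subtype_ne (fun i => (deg G i : ℝ) ^ 2) r]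
      exact le_add_of_nonneg_left (by positivity)
    rw [hq, hQ, ← Real.sqrt_mul (by linarith)]
    exact Real.le_sqrt_of_sq_le (hcs.trans (mul_le_mul_of_nonneg_left hle (by linarith)))
  have hQ0 : 0 ≤ Q := Real.sqrt_nonneg _
  have hd : (0 : ℝ) ≤ deg G r := by positivity
  -- The trace bound controls `(N - 1) l = q ^ 2 l`. Since `q ≥ 1`, enlarging both terms of `q Q +
  -- deg r` produces the common factor `q ^ 2`.
  refine le_of_mul_le_mul_left (a := q ^ 2) ?_ (by positivity)
  rw [hqq]
  refine (h1.trans h2).trans ?_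
  rw [← hqq]
  have e1 : q * Q ≤ q ^ 2 * Q := by
    apply mul_le_mul_of_nonneg_right _ hQ0
    nlinarith
  have e2 : (deg G r : ℝ) ≤ q ^ 2 * (q * deg G r) := by
    rw [← mul_assoc]
    refine le_mul_of_one_le_left hd ?_
    nlinarith
  linarith

end Laplacian

/-! ### Exponentials of nonnegative matrices and contraction by stochastic matrices -/

section NonnegativeMatrices

variable {k : Type} [Fintype k] [DecidableEq k]

theorem pow_entry_nonneg {B : Matrix k k ℝ} (hB : ∀ i j, 0 ≤ B i j) (n : ℕ) (i j : k) :
    0 ≤ (B ^ n) i j := by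
  induction n generalizing i j with
  | zero =>
    rw [pow_zero, Matrix.one_apply]
    split_ifs <;> norm_num
  | succ n ih =>
    rw [pow_succ, Matrix.mul_apply]
    exact Finset.sum_nonneg fun l _ => mul_nonneg (ih i l) (hB l j)

open scoped Matrix.Norms.L2Operator in
theorem hasSum_exp (B : Matrix k k ℝ) :
    HasSum (fun n : ℕ => ((n.factorial : ℝ)⁻¹) • B ^ n) (NormedSpace.exp B) :=
  NormedSpace.exp_series_hasSum_exp' B

theorem hasSum_exp_entry (B : Matrix k k ℝ) (i j : k) :
    HasSum (fun n : ℕ => ((n.factorial : ℝ)⁻¹) * (B ^ n) i j) (NormedSpace.exp B i j) := by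
  have := (Pi.hasSum.1 ((Pi.hasSum.1 (hasSum_exp B)) i)) j
  simpa using this

theorem pow_entry_le_exp {B : Matrix k k ℝ} (hB : ∀ i j, 0 ≤ B i j) (n : ℕ) (i j : k) :
    ((n.factorial : ℝ)⁻¹) * (B ^ n) i j ≤ NormedSpace.exp B i j :=
  le_hasSum (hasSum_exp_entry B i j) n fun m _ =>
    mul_nonneg (by positivity) (pow_entry_nonneg hB m i j)

theorem exp_entry_nonneg {B : Matrix k k ℝ} (hB : ∀ i j, 0 ≤ B i j) (i j : k) :
    0 ≤ NormedSpace.exp B i j :=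
  (mul_nonneg (by positivity) (pow_entry_nonneg hB 0 i j)).trans (pow_entry_le_exp hB 0 i j)

theorem sum_exp_smul_of_sum_eq_zero {A : Matrix k k ℝ} (hA : ∀ i, ∑ j, A i j = 0) (s : ℝ) (i : k) :
    ∑ j, NormedSpace.exp (s • A) i j = 1 := by
  have hd : ∀ s : ℝ, HasDerivAt (fun u : ℝ => ∑ j, NormedSpace.exp (u • A) i j) 0 s := by
    intro s
    have h := HasDerivAt.fun_sum (u := Finset.univ) fun j _ => hasDerivAt_exp_smul_entry A s i j
    refine h.congr_deriv ?_
    simp only [Matrix.mul_apply]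
    rw [Finset.sum_comm]
    simp [← Finset.mul_sum, hA]
  have h := is_const_of_deriv_eq_zero (fun u => (hd u).differentiableAt) (fun u => (hd u).deriv) s 0
  rw [h]
  simp [Matrix.one_apply]

/-- The relation passes to powers and then, entry by entry, to the exponential series; `T` may be
rectangular. -/
theorem mul_exp_smul_of_intertwining {m : Type} [Fintype m] [DecidableEq m] {T : Matrix m k ℝ}
    {A : Matrix k k ℝ} {B : Matrix m m ℝ} (h : T * A = B * T) (s : ℝ) :
    T * NormedSpace.exp (s • A) = NormedSpace.exp (s • B) * T := by
  have hs : T * (s • A) = (s • B) * T := by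
    rw [Matrix.mul_smul, h, Matrix.smul_mul]
  have hpow : ∀ n : ℕ, T * (s • A) ^ n = (s • B) ^ n * T := by
    intro n
    induction n with
    | zero => simp
    | succ n ih => rw [pow_succ, pow_succ, ← Matrix.mul_assoc, ih, Matrix.mul_assoc, hs,
        Matrix.mul_assoc]
  ext i j
  simp only [Matrix.mul_apply]
  have h1 := hasSum_sum (s := Finset.univ) fun l _ => (hasSum_exp_entry (s • A) l j).mul_left (T i l)
  have h2 := hasSum_sum (s := Finset.univ) fun l _ =>
    (hasSum_exp_entry (s • B) i l).mul_right (T l j)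
  refine h1.unique ?_
  convert h2 using 2 with n
  have := congrFun (congrFun (hpow n) i) j
  simp only [Matrix.mul_apply] at this
  simp only [mul_left_comm (T _ _), mul_assoc, ← Finset.mul_sum, this]

/-- All components of `x` lie in an interval of length `δ`. -/
def InBand (x : k → ℝ) (δ : ℝ) : Prop := ∃ c, ∀ j, c ≤ x j ∧ x j ≤ c + δ

/-- Every row puts weight at least `ε` on the same component `r`. This shared part `ε * x r` shifts
all outputs equally, and the remaining nonnegative weights have sum `1 - ε`. -/
theorem InBand.mulVec {Q : Matrix k k ℝ} {r : k} {ε : ℝ} (hQ : ∀ i j, 0 ≤ Q i j)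
    (hsum : ∀ i, ∑ j, Q i j = 1) (hε : ∀ i, ε ≤ Q i r) {x : k → ℝ} {δ : ℝ} (hx : InBand x δ) :
    InBand (Q.mulVec x) ((1 - ε) * δ) := by
  obtain ⟨c, hc⟩ := hx
  refine ⟨ε * x r + (1 - ε) * c, fun i => ?_⟩
  have hR : ∀ j, 0 ≤ Q i j - ε * (Pi.single r (1 : ℝ) : k → ℝ) j := by
    intro j
    by_cases hj : j = r
    · subst hj
      simpa using hε i
    · simpa [hj] using hQ i j
  have hRs : ∑ j, (Q i j - ε * (Pi.single r (1 : ℝ) : k → ℝ) j) = 1 - ε := by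
    rw [Finset.sum_sub_distrib, hsum, ← Finset.mul_sum]
    simp
  have hval : Q.mulVec x i
      = ε * x r + ∑ j, (Q i j - ε * (Pi.single r (1 : ℝ) : k → ℝ) j) * x j := by
    simp [sub_mul, Finset.sum_sub_distrib, Matrix.mulVec, dotProduct,
      Pi.single_apply]
  rw [hval, add_assoc, ← mul_add, ← hRs, Finset.sum_mul, Finset.sum_mul]
  constructor
  · gcongr with j
    · exact hR j
    · exact (hc j).1
  · gcongr with j
    · exact hR j
    · exact (hc j).2

end NonnegativeMatrices

/-! ### Existence of a decay pair -/

section Decay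

variable {N : ℕ} (G : Digraph (Fin N)) (r : Fin N)

theorem exists_pow_entry_pos {B : Matrix (Fin N) (Fin N) ℝ} (hB : ∀ i j, 0 ≤ B i j)
    (hadj : ∀ i j, G.Adj j i → 0 < B i j) {i : Fin N} (h : Relation.ReflTransGen G.Adj r i) :
    ∃ n, 0 < (B ^ n) i r := by
  induction h with
  | refl => exact ⟨0, by simp⟩
  | @tail b c _ hbc ih =>
    obtain ⟨n, hn⟩ := ih
    refine ⟨n + 1, ?_⟩
    rw [pow_succ', Matrix.mul_apply]
    exact (mul_pos (hadj c b hbc) hn).trans_le (Finset.single_le_sum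
      (f := fun l => B c l * (B ^ n) l r)
      (fun l _ => mul_nonneg (hB c l) (pow_entry_nonneg hB n l r)) (Finset.mem_univ b))

/-- Shifting by `N`, which dominates every degree, makes `-ℒ` nonnegative and keeps it positive
along edges. Powers of the shifted matrix therefore detect directed paths from the root. -/
theorem adjacency_le_shifted (i j : Fin N) :
    adjacency G i j ≤ (((N : ℝ) • 1 - laplacian G) : Matrix (Fin N) (Fin N) ℝ) i j := by
  rw [Matrix.sub_apply, Matrix.smul_apply, Matrix.one_apply, laplacian_apply]
  have : (deg G i : ℝ) ≤ N := by
    have := Finset.card_le_univ (nbrs G i)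
    rw [Fintype.card_fin] at this
    exact_mod_cast this
  by_cases h : i = j
  · subst h
    simp
    linarith
  · simp [h]

theorem exp_neg_laplacian_eq (s : ℝ) :
    NormedSpace.exp (-(s • laplacian G)) = Real.exp (-(s * N)) •
      NormedSpace.exp (s • ((N : ℝ) • 1 - laplacian G) : Matrix (Fin N) (Fin N) ℝ) := by
  have h : -(s • laplacian G) = (-(s * N)) • (1 : Matrix (Fin N) (Fin N) ℝ)
      + s • ((N : ℝ) • 1 - laplacian G) := by
    rw [smul_sub, smul_smul, neg_smul]
    abel
  rw [h, Matrix.exp_add_of_commute _ _ (((Commute.one_left _).smul_left _))]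
  have h1 : NormedSpace.exp ((-(s * N)) • (1 : Matrix (Fin N) (Fin N) ℝ))
      = Real.exp (-(s * N)) • 1 := by
    rw [Matrix.smul_one_eq_diagonal, Matrix.exp_diagonal, Matrix.smul_one_eq_diagonal]
    congr 1
    funext i
    rw [Pi.coe_exp, Real.exp_eq_exp_ℝ]
  rw [h1, Matrix.smul_mul, Matrix.one_mul]

theorem exp_neg_laplacian_nonneg {s : ℝ} (hs : 0 ≤ s) (i j : Fin N) :
    0 ≤ NormedSpace.exp (-(s • laplacian G)) i j := by
  rw [exp_neg_laplacian_eq, Matrix.smul_apply]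
  refine mul_nonneg (Real.exp_pos _).le (exp_entry_nonneg (fun i j => ?_) i j)
  exact mul_nonneg hs ((adjacency_nonneg G i j).trans (adjacency_le_shifted G i j))

theorem sum_exp_neg_laplacian (s : ℝ) (i : Fin N) :
    ∑ j, NormedSpace.exp (-(s • laplacian G)) i j = 1 := by
  rw [← neg_smul]
  exact sum_exp_smul_of_sum_eq_zero (sum_laplacian G) _ i

variable {G r}

theorem IsRoot.exp_neg_laplacian_pos (hr : IsRoot G r) (i : Fin N) :
    0 < NormedSpace.exp (-((1 : ℝ) • laplacian G)) i r := by
  rw [exp_neg_laplacian_eq, Matrix.smul_apply, one_smul]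
  have hB : ∀ i j, 0 ≤ (((N : ℝ) • 1 - laplacian G) : Matrix (Fin N) (Fin N) ℝ) i j := fun i j =>
    (adjacency_nonneg G i j).trans (adjacency_le_shifted G i j)
  obtain ⟨n, hn⟩ := exists_pow_entry_pos G r hB (fun i j h => by
    refine lt_of_lt_of_le ?_ (adjacency_le_shifted G i j)
    simp [adjacency, h]) (hr i)
  exact mul_pos (Real.exp_pos _) ((mul_pos (by positivity) hn).trans_le (pow_entry_le_exp hB n i r))

/-- Each whole unit of time contracts the band by `1 - ε`; the fractional time `f` merely does not
widen it. -/
theorem inBand_exp_neg_laplacian {ε : ℝ}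
    (hε : ∀ i, ε ≤ NormedSpace.exp (-((1 : ℝ) • laplacian G)) i r) (n : ℕ) {f : ℝ} (hf : 0 ≤ f)
    {x : Fin N → ℝ} (hx : InBand x 1) :
    InBand ((NormedSpace.exp (-((n + f) • laplacian G))).mulVec x) ((1 - ε) ^ n) := by
  induction n with
  | zero =>
    have := hx.mulVec (r := r) (exp_neg_laplacian_nonneg G hf) (sum_exp_neg_laplacian G f)
      (ε := 0) (fun i => exp_neg_laplacian_nonneg G hf i r)
    simpa using this
  | succ n ih =>
    have := ih.mulVec (exp_neg_laplacian_nonneg G zero_le_one) (sum_exp_neg_laplacian G 1) hε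
    rw [Matrix.mulVec_mulVec, ← neg_smul, ← neg_smul, ← exp_add_smul] at this
    rw [pow_succ']
    have e : -(((n + 1 : ℕ) + f) • laplacian G) = (-1 + -(n + f)) • laplacian G := by
      rw [← neg_smul]
      congr 1
      push_cast
      ring
    rwa [e]

/-- Maps the states to the disagreements with `r`. -/
def disagreementMatrix (r : Fin N) : Matrix {i : Fin N // i ≠ r} (Fin N) ℝ :=
  Matrix.of fun i j => (1 : Matrix (Fin N) (Fin N) ℝ) i j - (1 : Matrix (Fin N) (Fin N) ℝ) r j

theorem disagreementMatrix_mulVec (x : Fin N → ℝ) (i : {i : Fin N // i ≠ r}) :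
    (disagreementMatrix r).mulVec x i = x i - x r := by
  simp [disagreementMatrix, Matrix.mulVec, dotProduct, sub_mul, Matrix.one_apply]

/-- The rows of `ℒ` sum to zero, so `ℒ x` depends on `x` only through the differences `x k - x r`.
-/
theorem disagreementMatrix_mul_laplacian :
    disagreementMatrix r * laplacian G = reducedLaplacian G r * disagreementMatrix r := by
  ext i j
  have h1 : (disagreementMatrix r * laplacian G) i j = laplacian G i j - laplacian G r j := by
    simp [disagreementMatrix, Matrix.mul_apply, sub_mul, Matrix.one_apply]
  have h2 : ∀ l, ∑ k : {k : Fin N // k ≠ r}, velocityMatrix G r l k * disagreementMatrix r k j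
      = laplacian G l j := by
    intro l
    have e1 := sum_velocityMatrix_smul G r l fun k => (1 : Matrix (Fin N) (Fin N) ℝ) k j
    rw [← sum_laplacian_smul G l fun k => (1 : Matrix (Fin N) (Fin N) ℝ) k j] at e1
    simp only [smul_eq_mul] at e1
    have e2 : ∑ x, laplacian G l x * (1 : Matrix (Fin N) (Fin N) ℝ) x j = laplacian G l j := by
      rw [← Matrix.mul_apply, Matrix.mul_one]
    rw [e2] at e1
    exact e1
  rw [h1, Matrix.mul_apply]
  simp only [reducedLaplacian_apply, sub_mul, Finset.sum_sub_distrib, h2]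

theorem exists_isDecayPair (hr : IsRoot G r) : ∃ b l : ℝ, IsDecayPair G r b l := by
  have : Nonempty (Fin N) := ⟨r⟩
  obtain ⟨i₀, hi₀⟩ := Finite.exists_min fun i => NormedSpace.exp (-((1 : ℝ) • laplacian G)) i r
  set ε := NormedSpace.exp (-((1 : ℝ) • laplacian G)) i₀ r with hεdef
  have hε0 : 0 < ε := hr.exp_neg_laplacian_pos i₀
  have hε1 : ε ≤ 1 := by
    rw [← sum_exp_neg_laplacian G 1 i₀]
    exact Finset.single_le_sum (f := fun j => NormedSpace.exp (-((1 : ℝ) • laplacian G)) i₀ j)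
      (fun j _ => exp_neg_laplacian_nonneg G zero_le_one i₀ j) (Finset.mem_univ r)
  obtain ⟨C, hC, hCle⟩ := specNorm_le_of_entry_le (m := {i : Fin N // i ≠ r})
    (k := {i : Fin N // i ≠ r})
  refine ⟨C * Real.exp ε, ε, by positivity, hε0, fun s hs => ?_⟩
  rw [mul_assoc]
  refine hCle _ _ (by positivity) fun i j => ?_
  have hband : InBand ((NormedSpace.exp (-(s • laplacian G))).mulVec (Pi.single j.val 1))
      ((1 - ε) ^ ⌊s⌋₊) := by
    have := inBand_exp_neg_laplacian hi₀ ⌊s⌋₊ (f := s - ⌊s⌋₊)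
      (sub_nonneg.2 (Nat.floor_le hs)) (x := Pi.single j.val 1) ⟨0, fun l => by
        rw [Pi.single_apply]
        split_ifs <;> norm_num⟩
    simpa using this
  -- A unit vector of the reduced space is the disagreement of a unit vector of the full space. By
  -- intertwining, the entry is a difference of two components of one vector, hence at most the
  -- width of its band.
  have hentry : NormedSpace.exp (-(s • reducedLaplacian G r)) i j
      = (NormedSpace.exp (-(s • laplacian G))).mulVec (Pi.single j.val 1) i
        - (NormedSpace.exp (-(s • laplacian G))).mulVec (Pi.single j.val 1) r := by
    rw [← disagreementMatrix_mulVec, Matrix.mulVec_mulVec, ← neg_smul, ← neg_smul,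
      mul_exp_smul_of_intertwining disagreementMatrix_mul_laplacian, ← Matrix.mulVec_mulVec]
    have : (disagreementMatrix r).mulVec (Pi.single j.val 1) = Pi.single j 1 := by
      funext l
      rw [disagreementMatrix_mulVec]
      simp [Pi.single_apply, j.2.symm, Subtype.ext_iff]
    rw [this]
    simp
  obtain ⟨c, hc⟩ := hband
  -- The factor `exp ε` pays for rounding `s` down to an integer.
  have hpow : (1 - ε) ^ ⌊s⌋₊ ≤ Real.exp ε * Real.exp (-(ε * s)) := by
    calc (1 - ε) ^ ⌊s⌋₊ ≤ Real.exp (-ε) ^ ⌊s⌋₊ := by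
          refine pow_le_pow_left₀ (by linarith) ?_ _
          linarith [Real.add_one_le_exp (-ε)]
      _ ≤ _ := by
          rw [← Real.exp_nat_mul, ← Real.exp_add]
          gcongr
          nlinarith [Nat.lt_floor_add_one s]
  rw [hentry, abs_le]
  constructor <;> linarith [(hc i).1, (hc i).2, (hc r).1, (hc r).2]

end Decay

/-! ### Variation of constants for the disagreements -/

section Disagreement

theorem sqrt_sum_norm_sub_sq_le {ι E : Type*} [Fintype ι] [NormedAddCommGroup E] (v : ι → E)
    (w : E) : √(∑ i, ‖v i - w‖ ^ 2) ≤ √(∑ i, ‖v i‖ ^ 2) + √(Fintype.card ι) * ‖w‖ := by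
  have h := norm_sub_le (WithLp.toLp 2 v : PiLp 2 fun _ : ι => E) (WithLp.toLp 2 fun _ => w)
  rw [PiLp.norm_eq_of_L2, PiLp.norm_eq_of_L2, PiLp.norm_eq_of_L2] at h
  simpa [Real.sqrt_sq] using h

theorem continuousSMul_piLp (ι E : Type*) [Fintype ι] [NormedAddCommGroup E] [NormedSpace ℝ E] :
    ContinuousSMul ℝ (PiLp 2 fun _ : ι => E) := inferInstance

theorem HasDerivWithinAt.toLp {ι E : Type*} [Fintype ι] [NormedAddCommGroup E] [NormedSpace ℝ E]
    {f : ι → ℝ → E} {f' : ι → E} {S : Set ℝ} {s : ℝ}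
    (h : ∀ i, HasDerivWithinAt (f i) (f' i) S s) :
    HasDerivWithinAt (fun u => (WithLp.toLp 2 fun i => f i u : PiLp 2 fun _ : ι => E))
      (WithLp.toLp 2 f') S s := by
  have h1 := hasDerivWithinAt_pi.2 h
  exact (PiLp.hasFDerivAt_toLp (𝕜 := ℝ) 2 (fun i => f i s)).comp_hasDerivWithinAt s h1

variable {N n : ℕ} {G : Digraph (Fin N)} {r : Fin N}

/-- `exp ((v - t) M)` is the integrating factor of `η' = -M η + (z_j - z_r)`: the terms with `M`
cancel. -/
theorem hasDerivWithinAt_exp_mul_disagreement {x : Fin N → ℝ → EuclideanSpace ℝ (Fin n)}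
    {u z : Fin N → EuclideanSpace ℝ (Fin n)} {s : ℝ} (t : ℝ)
    (hderiv : ∀ i, HasDerivWithinAt (x i) (u i) (Set.Ici s) s)
    (hu : ∀ i, u i = z i - ∑ j ∈ nbrs G i, (x i s - x j s)) (i : {i : Fin N // i ≠ r}) :
    HasDerivWithinAt (fun v => ∑ j : {j : Fin N // j ≠ r},
        NormedSpace.exp ((v - t) • reducedLaplacian G r) i j • (x j v - x r v))
      (∑ j : {j : Fin N // j ≠ r},
        NormedSpace.exp ((s - t) • reducedLaplacian G r) i j • (z j - z r)) (Set.Ici s) s := by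
  set M := reducedLaplacian G r
  set E := NormedSpace.exp ((s - t) • M) with hE
  have h1 : ∀ j : {j : Fin N // j ≠ r}, HasDerivWithinAt
      (fun v => NormedSpace.exp ((v - t) • M) i j • (x j v - x r v))
      (E i j • (u j - u r) + (E * M) i j • (x j s - x r s)) (Set.Ici s) s := fun j =>
    (((hasDerivAt_exp_smul_entry M (s - t) i j).comp_sub_const s t).hasDerivWithinAt).smul
      ((hderiv j).sub (hderiv r))
  refine (HasDerivWithinAt.fun_sum (u := Finset.univ) fun j _ => h1 j).congr_deriv ?_
  have h2 : ∀ j : {j : Fin N // j ≠ r},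
      u j - u r = z j - z r - ∑ k, M j k • (x k s - x r s) := by
    intro j
    rw [hu, hu, ← sum_velocityMatrix_smul G r j fun k => x k s,
      ← sum_velocityMatrix_smul G r r fun k => x k s]
    simp only [M, reducedLaplacian_apply, sub_smul, Finset.sum_sub_distrib]
    abel
  simp only [h2, smul_sub, Matrix.mul_apply, Finset.sum_add_distrib, Finset.sum_sub_distrib,
    Finset.smul_sum, Finset.sum_smul, smul_smul]
  rw [Finset.sum_comm (f := fun j k => (E i j * M j k) • x k s),
    Finset.sum_comm (f := fun j k => (E i j * M j k) • x r s)]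
  abel

theorem sqrt_sum_disturbance_sq_le {z : Fin N → EuclideanSpace ℝ (Fin n)} {c : ℝ} (hc : 0 ≤ c)
    (hz : ∀ i, ‖z i‖ ≤ deg G i * c) :
    √(∑ j : {j : Fin N // j ≠ r}, ‖z j - z r‖ ^ 2)
      ≤ √(∑ i, (deg G i : ℝ) ^ 2) * c + √((N : ℝ) - 1) * (deg G r * c) := by
  have hNr : 1 ≤ N := r.pos
  refine (sqrt_sum_norm_sub_sq_le _ _).trans ?_
  rw [card_subtype_ne, Nat.cast_sub hNr, Nat.cast_one]
  refine add_le_add ?_ (mul_le_mul_of_nonneg_left (hz r) (Real.sqrt_nonneg _))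
  calc √(∑ j : {j : Fin N // j ≠ r}, ‖z j‖ ^ 2) ≤ √(∑ j, (deg G j * c) ^ 2) := by
        apply Real.sqrt_le_sqrt
        rw [Fintype.sum_eq_add_sum_subtype_ne (fun j => (deg G j * c) ^ 2) r]
        refine le_add_of_nonneg_of_le (by positivity) (Finset.sum_le_sum fun j _ => ?_)
        exact pow_le_pow_left₀ (norm_nonneg _) (hz j) 2
    _ = √(∑ i, (deg G i : ℝ) ^ 2) * c := by
        simp only [mul_pow (deg G _ : ℝ), ← Finset.sum_mul]
        rw [Real.sqrt_mul (by positivity), Real.sqrt_sq hc]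

/-- Variation of constants for the disagreements with the root. -/
theorem sqrt_sum_disagreement_sq_le {b l lam c W T : ℝ} (hdec : IsDecayPair G r b l)
    (hlam : lam < l) {x u z : Fin N → ℝ → EuclideanSpace ℝ (Fin n)}
    (hcont : ∀ i, ContinuousOn (x i) (Set.Icc 0 T))
    (hderiv : ∀ i, ∀ s ∈ Set.Ico 0 T, HasDerivWithinAt (x i) (u i s) (Set.Ici s) s)
    (hu : ∀ i, ∀ s ∈ Set.Ico 0 T, u i s = z i s - ∑ j ∈ nbrs G i, (x i s - x j s))
    (hc : 0 ≤ c)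
    (hz : ∀ i, ∀ s ∈ Set.Ico 0 T, ‖z i s‖ ≤ deg G i * (c * Real.exp (-(lam * s))))
    (hW : c * √(∑ i, (deg G i : ℝ) ^ 2) + √((N : ℝ) - 1) * deg G r * c ≤ W)
    {t : ℝ} (ht : t ∈ Set.Icc 0 T) :
    √(∑ j : {j : Fin N // j ≠ r}, ‖x j t - x r t‖ ^ 2) ≤
      b * eta0 r (fun i => x i 0) * Real.exp (-(l * t))
        + b * W / (l - lam) * (Real.exp (-(lam * t)) - Real.exp (-(l * t))) := by
  have := continuousSMul_piLp {i : Fin N // i ≠ r} (EuclideanSpace ℝ (Fin n))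
  set M := reducedLaplacian G r with hM
  have hE : ∀ s, s ≤ t → specNorm (NormedSpace.exp ((s - t) • M)) ≤ b * Real.exp (-(l * (t - s))) := by
    intro s hs
    have := hdec.2.2 (t - s) (by linarith)
    rwa [← neg_smul, neg_sub] at this
  have hsub : Set.Icc 0 t ⊆ Set.Icc 0 T := Set.Icc_subset_Icc_right ht.2
  set y : ℝ → PiLp 2 (fun _ : {i : Fin N // i ≠ r} => EuclideanSpace ℝ (Fin n)) :=
    fun v => WithLp.toLp 2 fun i => ∑ j : {j : Fin N // j ≠ r},
        NormedSpace.exp ((v - t) • M) i j • (x j v - x r v) with hy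
  have hycont : ContinuousOn y (Set.Icc 0 t) := by
    have : ∀ i j : {i : Fin N // i ≠ r},
        Continuous fun v : ℝ => NormedSpace.exp ((v - t) • M) i j := fun i j =>
      continuous_iff_continuousAt.2 fun v =>
        ((hasDerivAt_exp_smul_entry M (v - t) i j).comp_sub_const v t).continuousAt
    refine (PiLp.continuous_toLp 2 _).comp_continuousOn (continuousOn_pi.2 fun i => ?_)
    exact continuousOn_finsetSum _ fun j _ => (this i j).continuousOn.smul
      (((hcont j).mono hsub).sub ((hcont r).mono hsub))
  have hyderiv : ∀ s ∈ Set.Ico 0 t, HasDerivWithinAt y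
      (WithLp.toLp 2 fun i : {i : Fin N // i ≠ r} => ∑ j : {j : Fin N // j ≠ r},
        NormedSpace.exp ((s - t) • M) i j • (z j s - z r s)) (Set.Ici s) s := by
    intro s hs
    have hs' : s ∈ Set.Ico 0 T := ⟨hs.1, hs.2.trans_le ht.2⟩
    exact HasDerivWithinAt.toLp fun i => hasDerivWithinAt_exp_mul_disagreement t
      (fun i => hderiv i s hs') (fun i => hu i s hs') i
  have hnorm : ∀ (s : ℝ) (v : {i : Fin N // i ≠ r} → EuclideanSpace ℝ (Fin n)), s ≤ t →
      ‖(WithLp.toLp 2 fun i : {i : Fin N // i ≠ r} => ∑ j : {j : Fin N // j ≠ r},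
        NormedSpace.exp ((s - t) • M) i j • v j :
          PiLp 2 (fun _ : {i : Fin N // i ≠ r} => EuclideanSpace ℝ (Fin n)))‖
        ≤ b * Real.exp (-(l * (t - s))) * √(∑ j, ‖v j‖ ^ 2) := by
    intro s v hs
    rw [PiLp.norm_eq_of_L2]
    exact (sqrt_sum_norm_sq_smul_le _ _).trans
      (mul_le_mul_of_nonneg_right (hE s hs) (Real.sqrt_nonneg _))
  have hzsum : ∀ s ∈ Set.Ico 0 T, √(∑ j : {j : Fin N // j ≠ r}, ‖z j s - z r s‖ ^ 2)
      ≤ W * Real.exp (-(lam * s)) := by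
    intro s hs
    have h1 := sqrt_sum_disturbance_sq_le (r := r) (mul_nonneg hc (Real.exp_pos (-(lam * s))).le)
      (fun i => hz i s hs)
    have h2 := mul_le_mul_of_nonneg_right hW (Real.exp_pos (-(lam * s))).le
    linarith
  -- `B` is the scalar majorant of `‖y‖`: it starts at the bound for `‖y 0‖`, and its derivative
  -- `B'` bounds the right derivative of `y`. At `s = t` the integrating factor is the identity, so
  -- `y t` is the disagreement itself.
  set B : ℝ → ℝ := fun s => b * eta0 r (fun i => x i 0) * Real.exp (-(l * t))
        + b * W / (l - lam) * Real.exp (-(l * t)) * (Real.exp ((l - lam) * s) - 1) with hB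
  set B' : ℝ → ℝ := fun s => b * W * Real.exp (-(l * t)) * Real.exp ((l - lam) * s) with hB'
  have hBderiv : ∀ s, HasDerivAt B (B' s) s := by
    intro s
    have h1 := ((((hasDerivAt_id s).const_mul (l - lam)).exp).sub_const 1).const_mul
      (b * W / (l - lam) * Real.exp (-(l * t)))
    refine (h1.const_add _).congr_deriv ?_
    have : l - lam ≠ 0 := by linarith
    simp only [id, hB']
    field_simp
  have hB0 : ‖y 0‖ ≤ B 0 := by
    have h0 := hnorm 0 (fun j => x j 0 - x r 0) ht.1
    refine h0.trans (le_of_eq ?_)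
    have : ∑ i, ‖x i 0 - x r 0‖ ^ 2 = ∑ j : {j : Fin N // j ≠ r}, ‖x j 0 - x r 0‖ ^ 2 := by
      rw [Fintype.sum_eq_add_sum_subtype_ne (fun i => ‖x i 0 - x r 0‖ ^ 2) r]
      simp
    simp only [hB]
    rw [eta0, this, sub_zero, mul_zero, Real.exp_zero, sub_self, mul_zero, add_zero]
    ring
  have hbound : ∀ s ∈ Set.Ico 0 t, ‖(WithLp.toLp 2 fun i : {i : Fin N // i ≠ r} =>
      ∑ j : {j : Fin N // j ≠ r}, NormedSpace.exp ((s - t) • M) i j • (z j s - z r s) :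
        PiLp 2 (fun _ : {i : Fin N // i ≠ r} => EuclideanSpace ℝ (Fin n)))‖ ≤ B' s := by
    intro s hs
    refine (hnorm s (fun j => z j s - z r s) hs.2.le).trans ?_
    refine (mul_le_mul_of_nonneg_left (hzsum s ⟨hs.1, hs.2.trans_le ht.2⟩)
      (mul_nonneg hdec.1.le (Real.exp_pos _).le)).trans (le_of_eq ?_)
    have e : Real.exp (-(l * (t - s))) * Real.exp (-(lam * s))
        = Real.exp (-(l * t)) * Real.exp ((l - lam) * s) := by
      rw [← Real.exp_add, ← Real.exp_add]
      ring_nf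
    simp only [hB']
    linear_combination b * W * e
  have hmain := image_norm_le_of_norm_deriv_right_le_deriv_boundary hycont hyderiv hB0 hBderiv
    hbound
  have hfin := hmain (Set.right_mem_Icc.2 ht.1)
  rw [hy, PiLp.norm_eq_of_L2] at hfin
  simp only [sub_self, zero_smul, NormedSpace.exp_zero, Matrix.one_apply, ite_smul, one_smul,
    Finset.sum_ite_eq, Finset.mem_univ, if_true] at hfin
  refine hfin.trans (le_of_eq ?_)
  have e : Real.exp (-(lam * t)) = Real.exp (-(l * t)) * Real.exp ((l - lam) * t) := by
    rw [← Real.exp_add]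
    ring_nf
  rw [e]
  ring

end Disagreement

/-! ### Scalar inequalities for the distance travelled -/

section Scalar

/-- With `a = exp (λ d)` and `b = exp (λ̂ d)`, the left side is the travel plus a reserve. The
reserve is the gap to the right side in the worst case `h = P`, `g = -P`. -/
theorem travel_slack {lam l P h g a b : ℝ} (hlam : 0 < lam) (hl : lam < l)
    (hh : P ≤ h) (hg : -P ≤ g) (ha : 1 ≤ a) (hab : a ≤ b) :
    h / lam * (a - 1) + g / l * (a - a / b) + (b - a) * (P / lam - P / l + P / (l * b))
      ≤ (h / lam + g / l) * (b - 1) := by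
  have hb : 1 ≤ b := ha.trans hab
  have hl0 : 0 < l := hlam.trans hl
  have hb0 : 0 < b := by linarith
  have e : (h / lam + g / l) * (b - 1) - (h / lam * (a - 1) + g / l * (a - a / b)
      + (b - a) * (P / lam - P / l + P / (l * b)))
      = (b - a) * ((h - P) / lam + (g + P) / l * ((b - 1) / b)) := by
    field_simp
    ring
  have h1 : 0 ≤ (h - P) / lam := div_nonneg (by linarith) hlam.le
  have h2 : 0 ≤ (g + P) / l := div_nonneg (by linarith) hl0.le
  have h3 : 0 ≤ (b - 1) / b := div_nonneg (by linarith) hb0.le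
  have : 0 ≤ (b - a) * ((h - P) / lam + (g + P) / l * ((b - 1) / b)) :=
    mul_nonneg (by linarith) (by positivity)
  linarith

/-- The share `gd` granted to the delays also covers the growth of the share `gl` during the
delay `d`. -/
theorem travel_strict {lam l P h g d gl gd : ℝ} (hlam : 0 < lam) (hl : lam < l)
    (hh : P ≤ h) (hg : -P ≤ g) (hd : 0 ≤ d) (hgl : 0 ≤ gl) (hgd : 0 < gd)
    (hP : lam * l * (gl + gd) ≤ P * (l - lam))
    (hD : (h / lam + g / l) * (Real.exp (l * d) - 1) ≤ gd) :
    gl * Real.exp (lam * d) + (h / lam * (Real.exp (lam * d) - 1)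
      + g / l * (Real.exp (lam * d) - Real.exp (lam * d) / Real.exp (l * d))) < gl + gd := by
  rcases hd.eq_or_lt with rfl | hd
  · simp [hgd]
  set a := Real.exp (lam * d) with ha_def
  set b := Real.exp (l * d) with hb_def
  have hl0 : 0 < l := hlam.trans hl
  have ha : 1 ≤ a := Real.one_le_exp (by positivity)
  have ha0 : 0 < a := by linarith
  have hab : a < b := Real.exp_lt_exp.2 (mul_lt_mul_of_pos_right hl hd)
  have hb0 : 0 < b := by linarith
  have hll : 0 < l - lam := by linarith
  set γ := gl + gd with hγ
  have hγ0 : 0 < γ := by linarith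
  have hPl : γ ≤ P / lam - P / l := by
    have : P / lam - P / l = P * (l - lam) / (lam * l) := by
      field_simp
    rw [this, le_div_iff₀ (by positivity)]
    linarith
  have hP2 : lam * γ / (l - lam) ≤ P / l := by
    rw [div_le_div_iff₀ hll hl0]
    linarith
  have hDγ : γ ≤ h / lam + g / l := by
    have h1 : P / lam ≤ h / lam := by gcongr
    have h2 : -P / l ≤ g / l := by gcongr
    rw [neg_div] at h2
    linarith
  have hb1 : γ * (b - 1) ≤ gd :=
    (mul_le_mul_of_nonneg_right hDγ (by linarith)).trans hD
  -- From `γ (b - 1) ≤ gd` one gets `gl ≤ γ (2 - b)`, and `b (2 - b) ≤ 1`.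
  have hglb : gl * b ≤ γ := by
    have h1 : gl ≤ γ * (2 - b) := by linarith
    have h2 := mul_le_mul_of_nonneg_right h1 hb0.le
    nlinarith [mul_nonneg hγ0.le (sq_nonneg (b - 1))]
  have hba : (l - lam) * d * a ≤ b - a := by
    have : b = a * Real.exp ((l - lam) * d) := by
      rw [ha_def, hb_def, ← Real.exp_add]
      ring_nf
    have h2 := Real.add_one_le_exp ((l - lam) * d)
    nlinarith
  have ha1 : a - 1 ≤ lam * d * a := by
    have h1 : a * Real.exp (-(lam * d)) = 1 := by
      rw [ha_def, ← Real.exp_add]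
      simp
    have h2 := Real.add_one_le_exp (-(lam * d))
    nlinarith
  have hgrow : a - 1 < (b - a) * (b + lam / (l - lam)) := by
    have h1 : lam * d * a < l * d * a := by gcongr
    have h2 : l * d * a ≤ (b - a) * (1 + lam / (l - lam)) := by
      have : 1 + lam / (l - lam) = l / (l - lam) := by
        field_simp
        ring
      rw [this, mul_div_assoc', le_div_iff₀ hll]
      nlinarith
    have h3 : (b - a) * (1 + lam / (l - lam)) ≤ (b - a) * (b + lam / (l - lam)) := by
      apply mul_le_mul_of_nonneg_left _ (by linarith)
      linarith
    linarith
  -- The growth `gl * (a - 1)` of the dropout share fits into the reserve of `travel_slack`.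
  have hfin : gl * (a - 1) < (b - a) * (P / lam - P / l + P / (l * b)) := by
    have h1 : gl * b * (a - 1) ≤ γ * (a - 1) := by
      apply mul_le_mul_of_nonneg_right hglb
      linarith
    have h2 : γ * (a - 1) < γ * ((b - a) * (b + lam / (l - lam))) := by gcongr
    have h3 : γ * ((b - a) * (b + lam / (l - lam)))
        ≤ (b - a) * (P / lam - P / l + P / (l * b)) * b := by
      have e : (b - a) * (P / lam - P / l + P / (l * b)) * b
          = (b - a) * ((P / lam - P / l) * b + P / l) := by
        field_simp
      rw [e, mul_left_comm]
      apply mul_le_mul_of_nonneg_left _ (by linarith)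
      have : γ * (b + lam / (l - lam)) = γ * b + lam * γ / (l - lam) := by ring
      rw [this]
      gcongr
    refine lt_of_mul_lt_mul_right ?_ hb0.le
    linarith
  have := travel_slack hlam hl hh hg ha hab.le
  linarith

end Scalar

/-! ### Events and receptions along a run -/

namespace Run

variable {N n : ℕ} {R : Run N n} {G : Digraph (Fin N)} {p : Params}

theorem Before.mono {s s' : ℝ} (h : R.Before s) (hs : s' ≤ s) : R.Before s' := fun i =>
  let ⟨k, hk⟩ := h i
  ⟨k, hs.trans_lt hk⟩

namespace IsExecution

variable (hR : R.IsExecution G p)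

include hR

theorem lt_next (i : Fin N) (k : ℕ) : R.t i k < R.t i (k + 1) := (hR.next_event i k).1.1

theorem strictMono_t (i : Fin N) : StrictMono (R.t i) := strictMono_nat_of_lt_succ (hR.lt_next i)

theorem t_nonneg (i : Fin N) (k : ℕ) : 0 ≤ R.t i k := by
  rw [← hR.first_event i]
  exact (hR.strictMono_t i).monotone (Nat.zero_le k)

theorem next_le (hδ : 0 < p.deltaBar) (i : Fin N) (k : ℕ) :
    R.t i (k + 1) ≤ R.t i k + p.deltaBar :=
  (hR.next_event i k).2 ⟨by linarith, Or.inr rfl⟩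

theorem t_add_le (hδ : 0 < p.deltaBar) (i : Fin N) (k q : ℕ) :
    R.t i (k + q) ≤ R.t i k + q * p.deltaBar := by
  induction q with
  | zero => simp
  | succ q ih =>
    have := hR.next_le hδ i (k + q)
    rw [← add_assoc]
    push_cast
    linarith

theorem continuousOn_Icc {T : ℝ} (hT : R.Before T) (i : Fin N) :
    ContinuousOn (R.x i) (Set.Icc 0 T) :=
  (hR.continuous i).mono fun _ hs => ⟨hs.1, hT.mono hs.2⟩

/-- The error starts at zero; exceeding the threshold would require an earlier crossing, hence an
event strictly before `t i (k + 1)`. -/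
theorem norm_event_sub_le (hβ : 0 < p.beta) {i : Fin N} {k : ℕ} {s : ℝ} (hs : R.Before s)
    (h1 : R.t i k ≤ s) (h2 : s ≤ R.t i (k + 1)) :
    ‖R.x i (R.t i k) - R.x i s‖ ≤ p.beta * Real.exp (-(p.lam * s)) := by
  by_contra! hlt
  have hcont : ContinuousOn
      (fun v => ‖R.x i (R.t i k) - R.x i v‖ - p.beta * Real.exp (-(p.lam * v)))
      (Set.Icc (R.t i k) s) := by
    have hx := (hR.continuousOn_Icc hs i).mono (Set.Icc_subset_Icc_left (hR.t_nonneg i k))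
    exact ((continuousOn_const.sub hx).norm).sub (by fun_prop)
  have hneg : -(p.beta * Real.exp (-(p.lam * R.t i k))) < 0 :=
    neg_lt_zero.2 (mul_pos hβ (Real.exp_pos _))
  obtain ⟨v, hv, hv0⟩ := intermediate_value_Ioo h1 hcont
    (show (0 : ℝ) ∈ Set.Ioo _ _ by
      constructor
      · simpa using mul_pos hβ (Real.exp_pos _)
      · simpa using hlt)
  have := (hR.next_event i k).2 ⟨hv.1, Or.inl (sub_eq_zero.1 hv0)⟩
  linarith [hv.2]

theorem lastEvent_spec {i : Fin N} {s : ℝ} (hs0 : 0 ≤ s) (hs : R.Before s) :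
    R.t i (R.lastEvent i s) ≤ s ∧ s < R.t i (R.lastEvent i s + 1) := by
  obtain ⟨K, hK⟩ := hs i
  -- The `sSup` of an unbounded set of naturals is `0`; `Before` is what makes `lastEvent`
  -- meaningful.
  have hbdd : BddAbove {k | R.t i k ≤ s} := ⟨K, fun k hk =>
    ((hR.strictMono_t i).lt_iff_lt.1 (hk.trans_lt hK)).le⟩
  refine ⟨Nat.sSup_mem ⟨0, by simpa [hR.first_event i] using hs0⟩ hbdd, ?_⟩
  by_contra! h
  have : R.lastEvent i s + 1 ≤ R.lastEvent i s := le_csSup hbdd h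
  omega

theorem lastRecv_spec {i j : Fin N} (hij : G.Adj i j) {s : ℝ} (hs0 : 0 ≤ s) (hs : R.Before s) :
    R.t i (R.lastRecv i j s) ≤ s ∧ ∃ q, 1 ≤ q ∧ q ≤ p.rho ∧ R.recv i j (R.lastRecv i j s + q) ∧
      s < R.t i (R.lastRecv i j s + q) + R.delay i j (R.lastRecv i j s + q) := by
  obtain ⟨K, hK⟩ := hs i
  have hle : ∀ k, R.recv i j k ∧ R.t i k + R.delay i j k ≤ s → R.t i k ≤ s := fun k hk => by
    linarith [hk.2, hR.delay_nonneg i j hij k]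
  have hbdd : BddAbove {k | R.recv i j k ∧ R.t i k + R.delay i j k ≤ s} := ⟨K, fun k hk =>
    ((hR.strictMono_t i).lt_iff_lt.1 ((hle k hk).trans_lt hK)).le⟩
  have hfirst := hR.first_recv i j hij
  have hmem : R.recv i j (R.lastRecv i j s)
      ∧ R.t i (R.lastRecv i j s) + R.delay i j (R.lastRecv i j s) ≤ s :=
    Nat.sSup_mem (s := {k | R.recv i j k ∧ R.t i k + R.delay i j k ≤ s})
      ⟨0, hfirst.1, by simpa [hR.first_event i, hfirst.2] using hs0⟩ hbdd
  obtain ⟨q, hq1, hqρ, hq⟩ := hR.dropouts i j hij _ hmem.1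
  refine ⟨hle _ hmem, q, hq1, hqρ, hq, ?_⟩
  by_contra! h
  have : R.lastRecv i j s + q ≤ R.lastRecv i j s := le_csSup hbdd ⟨hq, h⟩
  omega

/-- Only the finitely many broadcasts with index below `K` can arrive just after `s`, and each
condition "arrived by `u`" is constant immediately to the right of `s`. -/
theorem lastRecv_eventually_eq {i j : Fin N} (hij : G.Adj i j) {s : ℝ} (hs : R.Before s) :
    ∀ᶠ u in 𝓝[≥] s, R.lastRecv i j u = R.lastRecv i j s := by
  obtain ⟨K, hK⟩ := hs i
  have h1 : ∀ᶠ u in 𝓝[≥] s, u < R.t i K :=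
    (eventually_lt_nhds hK).filter_mono nhdsWithin_le_nhds
  have h2 : ∀ᶠ u in 𝓝[≥] s, ∀ k ∈ Finset.range K,
      (R.t i k + R.delay i j k ≤ u ↔ R.t i k + R.delay i j k ≤ s) := by
    rw [Finset.eventually_all]
    intro k _
    by_cases hk : R.t i k + R.delay i j k ≤ s
    · filter_upwards [self_mem_nhdsWithin] with u hu
      exact iff_of_true (hk.trans hu) hk
    · filter_upwards [(eventually_lt_nhds (not_le.1 hk)).filter_mono nhdsWithin_le_nhds] with u hu
      exact iff_of_false hu.not_ge hk
  filter_upwards [h1, h2, self_mem_nhdsWithin] with u hu1 hu2 hu3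
  have hset : {k | R.recv i j k ∧ R.t i k + R.delay i j k ≤ u}
      = {k | R.recv i j k ∧ R.t i k + R.delay i j k ≤ s} := by
    ext k
    by_cases hk : k < K
    · simp only [Set.mem_ofPred_eq, hu2 k (Finset.mem_range.2 hk)]
    · have ht : R.t i K ≤ R.t i k := (hR.strictMono_t i).monotone (not_lt.1 hk)
      have hd := hR.delay_nonneg i j hij k
      have hsu : s ≤ u := hu3
      exact iff_of_false (fun h => by linarith [h.2]) (fun h => by linarith [h.2])
  rw [lastRecv, lastRecv, hset]

theorem norm_event_sub_event_le (hβ : 0 < p.beta) (i : Fin N) (m q : ℕ)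
    (h : R.Before (R.t i (m + q))) :
    ‖R.x i (R.t i m) - R.x i (R.t i (m + q))‖
      ≤ ∑ μ ∈ Finset.Icc 1 q, p.beta * Real.exp (-(p.lam * R.t i (m + μ))) := by
  induction q with
  | zero => simp
  | succ q ih =>
    rw [Finset.sum_Icc_succ_top (by omega)]
    have hlt : R.t i (m + q) < R.t i (m + (q + 1)) := hR.lt_next i (m + q)
    refine (norm_sub_le_norm_sub_add_norm_sub _ (R.x i (R.t i (m + q))) _).trans ?_
    exact add_le_add (ih (h.mono hlt.le)) (hR.norm_event_sub_le hβ h hlt.le le_rfl)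

end IsExecution

end Run

/-- This explains the form of `γ_l`. The current time is at most `ρ δ̄` after the last received
broadcast, and the `μ`-th event after that broadcast comes at least `μ τ₀` later than it. -/
theorem Params.sum_exp_le_gammaL {p : Params} (hβ : 0 < p.beta) (hlam : 0 < p.lam) {q : ℕ}
    (hq : q ≤ p.rho) {s : ℝ} {σ : ℕ → ℝ}
    (hσ : ∀ μ ∈ Finset.Icc 1 q, s - σ μ ≤ p.rho * p.deltaBar - μ * p.tau0) :
    ∑ μ ∈ Finset.Icc 1 q, p.beta * Real.exp (-(p.lam * σ μ))
      ≤ p.gammaL * Real.exp (-(p.lam * s)) := by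
  calc ∑ μ ∈ Finset.Icc 1 q, p.beta * Real.exp (-(p.lam * σ μ))
      ≤ ∑ μ ∈ Finset.Icc 1 q, p.beta * Real.exp (p.rho * p.lam * p.deltaBar)
          * Real.exp (-(μ * p.lam * p.tau0)) * Real.exp (-(p.lam * s)) := by
        refine Finset.sum_le_sum fun μ hμ => ?_
        rw [mul_assoc, mul_assoc, ← Real.exp_add, ← Real.exp_add]
        gcongr
        nlinarith [hσ μ hμ]
    _ ≤ ∑ μ ∈ Finset.Icc 1 p.rho, p.beta * Real.exp (p.rho * p.lam * p.deltaBar)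
          * Real.exp (-(μ * p.lam * p.tau0)) * Real.exp (-(p.lam * s)) :=
        Finset.sum_le_sum_of_subset_of_nonneg (Finset.Icc_subset_Icc_right hq)
          fun _ _ _ => by positivity
    _ = p.gammaL * Real.exp (-(p.lam * s)) := by
        rw [Params.gammaL, Finset.mul_sum, Finset.sum_mul]

/-! ### Relations between the constants, and positivity of the horizons -/

section Constants

variable {N n : ℕ} {G : Digraph (Fin N)} {r : Fin N} {p : Params}

theorem Params.gammaL_nonneg (hβ : 0 < p.beta) : 0 ≤ p.gammaL :=
  mul_nonneg (by positivity) (Finset.sum_nonneg fun _ _ => (Real.exp_pos _).le)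

theorem Params.gamma_pos (hβ : 0 < p.beta) (hγ : 0 < p.gammaD) : 0 < p.gamma :=
  add_pos_of_nonneg_of_pos (Params.gammaL_nonneg hβ) hγ

theorem sqrt_sum_deg_sq_le :
    √(∑ i, (deg G i : ℝ) ^ 2) ≤ (Finset.univ.sup (deg G) : ℕ) * √(N : ℝ) := by
  refine Real.sqrt_le_iff.2 ⟨by positivity, ?_⟩
  rw [mul_pow, Real.sq_sqrt (by positivity), mul_comm, ← nsmul_eq_mul]
  have := Finset.sum_le_card_nsmul Finset.univ (fun i => (deg G i : ℝ) ^ 2)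
    (((Finset.univ.sup (deg G) : ℕ) : ℝ) ^ 2) fun i _ => by
      have : deg G i ≤ Finset.univ.sup (deg G) := Finset.le_sup (Finset.mem_univ i)
      gcongr
  rwa [Finset.card_univ, Fintype.card_fin] at this

theorem Params.disturbance_le_Gam (hβ : 0 < p.beta) :
    (p.beta + p.gamma) * √(∑ i, (deg G i : ℝ) ^ 2)
      + √((N : ℝ) - 1) * deg G r * (p.beta + p.gamma) ≤ p.Gam G r := by
  have := mul_le_mul_of_nonneg_left (sqrt_sum_deg_sq_le (G := G)) hβ.le
  rw [Params.Gam]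
  linarith

/-- The gain of the loop through the delays. -/
theorem IsDecayPair.mul_gamma_le (hN : 2 ≤ N) (hdec : IsDecayPair G r p.betaHat p.lamHat)
    (hβ : 0 < p.beta) (hγ : 0 < p.gammaD) (hl : p.lam < p.lamHat) :
    p.lam * p.lamHat * p.gamma ≤ gainL G r * p.betaHat * p.Gam G r := by
  have hγ0 := Params.gamma_pos hβ hγ
  have hS := hdec.le_degrees hN
  have hb := hdec.one_le hN
  have hL : p.lamHat ≤ gainL G r := (hdec.le_specNorm hN).trans (le_max_left _ _)
  have hl0 := hdec.2.1
  set S := √(∑ i, (deg G i : ℝ) ^ 2) + √((N : ℝ) - 1) * deg G r with hSdef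
  have hS0 : 0 ≤ S := by positivity
  have h1 : p.lam * p.gamma ≤ p.Gam G r := by
    refine le_trans ?_ (Params.disturbance_le_Gam hβ)
    have : (p.beta + p.gamma) * √(∑ i, (deg G i : ℝ) ^ 2)
      + √((N : ℝ) - 1) * deg G r * (p.beta + p.gamma) = S * (p.beta + p.gamma) := by
      rw [hSdef]
      ring
    rw [this]
    have := mul_le_mul_of_nonneg_right (hl.le.trans hS) hγ0.le
    nlinarith [mul_nonneg hS0 hβ.le]
  have h2 : p.lamHat ≤ gainL G r * p.betaHat :=
    hL.trans (le_mul_of_one_le_right (hl0.le.trans hL) hb)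
  have h3 : 0 ≤ p.Gam G r := by
    unfold Params.Gam
    positivity
  calc p.lam * p.lamHat * p.gamma = p.lamHat * (p.lam * p.gamma) := by ring
    _ ≤ p.lamHat * p.Gam G r := by gcongr
    _ ≤ _ := by gcongr

/-- The quantity that limits how far an agent moves relative to the threshold. -/
noncomputable def growth (p : Params) (G : Digraph (Fin N)) (r : Fin N)
    (x0 : Fin N → EuclideanSpace ℝ (Fin n)) (i : Fin N) (s : ℝ) : ℝ :=
  H2 p G r i / p.lam + H1 p G r x0 * Real.exp ((p.lam - p.lamHat) * s) / p.lamHat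

theorem horizon_eq (x0 : Fin N → EuclideanSpace ℝ (Fin n)) (c : ℝ) (i : Fin N) (s : ℝ) :
    horizon p G r x0 c i s = 1 / p.lamHat * Real.log (1 + c / growth p G r x0 i s) := by
  rw [horizon, growth, div_mul_eq_mul_div (H1 p G r x0)]

/-- The steady part of `H2`. -/
noncomputable def steadyGain (p : Params) (G : Digraph (Fin N)) (r : Fin N) : ℝ :=
  gainL G r * p.betaHat * p.Gam G r / (p.lamHat - p.lam)

theorem steadyGain_le_H2 (hβ : 0 < p.beta) (hγ : 0 < p.gammaD) (i : Fin N) :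
    steadyGain p G r ≤ H2 p G r i := by
  have hγ0 := Params.gamma_pos hβ hγ
  exact le_add_of_nonneg_left (by positivity)

theorem lam_mul_gamma_le_steadyGain (hN : 2 ≤ N) (hdec : IsDecayPair G r p.betaHat p.lamHat)
    (hβ : 0 < p.beta) (hγ : 0 < p.gammaD) (hl : p.lam < p.lamHat) :
    p.lam * p.lamHat * (p.gammaL + p.gammaD) ≤ steadyGain p G r * (p.lamHat - p.lam) := by
  have := hdec.mul_gamma_le hN hβ hγ hl
  rwa [steadyGain, div_mul_cancel₀ _ (by linarith)]

theorem steadyGain_pos (hN : 2 ≤ N) (hdec : IsDecayPair G r p.betaHat p.lamHat)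
    (hβ : 0 < p.beta) (hγ : 0 < p.gammaD) (hlam : 0 < p.lam) (hl : p.lam < p.lamHat) :
    0 < steadyGain p G r := by
  have h1 := lam_mul_gamma_le_steadyGain hN hdec hβ hγ hl
  have h2 : 0 < p.lam * p.lamHat * (p.gammaL + p.gammaD) :=
    mul_pos (mul_pos hlam hdec.2.1) (Params.gamma_pos hβ hγ)
  exact pos_of_mul_pos_left (h2.trans_le h1) (by linarith)

theorem gainL_nonneg : 0 ≤ gainL G r := (specNorm_nonneg _).trans (le_max_left _ _)

theorem neg_steadyGain_le (hN : 2 ≤ N) (hdec : IsDecayPair G r p.betaHat p.lamHat)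
    (hβ : 0 < p.beta) (hγ : 0 < p.gammaD) (hlam : 0 < p.lam) (hl : p.lam < p.lamHat)
    (x0 : Fin N → EuclideanSpace ℝ (Fin n)) {s : ℝ} (hs : 0 ≤ s) :
    -steadyGain p G r ≤ H1 p G r x0 * Real.exp ((p.lam - p.lamHat) * s) := by
  have hP := steadyGain_pos hN hdec hβ hγ hlam hl
  have hE : Real.exp ((p.lam - p.lamHat) * s) ≤ 1 :=
    Real.exp_le_one_iff.2 (mul_nonpos_of_nonpos_of_nonneg (by linarith) hs)
  have hH : H1 p G r x0 = gainL G r * p.betaHat * eta0 r x0 - steadyGain p G r := by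
    rw [H1, steadyGain]
    ring
  have h0 : 0 ≤ gainL G r * p.betaHat * eta0 r x0 :=
    mul_nonneg (mul_nonneg gainL_nonneg hdec.1.le) (Real.sqrt_nonneg _)
  rw [hH]
  nlinarith [Real.exp_pos ((p.lam - p.lamHat) * s)]

/-- `H1` may be negative, but the steady part of `H2` outweighs it because `1/λ > 1/λ̂`. -/
theorem growth_pos (hN : 2 ≤ N) (hdec : IsDecayPair G r p.betaHat p.lamHat)
    (hβ : 0 < p.beta) (hγ : 0 < p.gammaD) (hlam : 0 < p.lam) (hl : p.lam < p.lamHat)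
    (x0 : Fin N → EuclideanSpace ℝ (Fin n)) (i : Fin N) {s : ℝ} (hs : 0 ≤ s) :
    0 < growth p G r x0 i s := by
  have hP := steadyGain_pos hN hdec hβ hγ hlam hl
  have h1 : steadyGain p G r / p.lam ≤ H2 p G r i / p.lam :=
    div_le_div_of_nonneg_right (steadyGain_le_H2 hβ hγ i) hlam.le
  have h2 : -steadyGain p G r / p.lamHat
      ≤ H1 p G r x0 * Real.exp ((p.lam - p.lamHat) * s) / p.lamHat :=
    div_le_div_of_nonneg_right (neg_steadyGain_le hN hdec hβ hγ hlam hl x0 hs) hdec.2.1.le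
  have h3 : steadyGain p G r / p.lamHat < steadyGain p G r / p.lam :=
    div_lt_div_of_pos_left hP hlam hl
  rw [neg_div] at h2
  rw [growth]
  linarith

theorem growth_le (hdec : IsDecayPair G r p.betaHat p.lamHat) (hl : p.lam < p.lamHat)
    (x0 : Fin N → EuclideanSpace ℝ (Fin n)) (i : Fin N) {s : ℝ} (hs : 0 ≤ s) :
    growth p G r x0 i s ≤ H2 p G r i / p.lam + |H1 p G r x0| / p.lamHat := by
  have hE : Real.exp ((p.lam - p.lamHat) * s) ≤ 1 :=
    Real.exp_le_one_iff.2 (mul_nonpos_of_nonpos_of_nonneg (by linarith) hs)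
  have h : H1 p G r x0 * Real.exp ((p.lam - p.lamHat) * s) ≤ |H1 p G r x0| := by
    calc H1 p G r x0 * Real.exp ((p.lam - p.lamHat) * s)
        ≤ |H1 p G r x0| * Real.exp ((p.lam - p.lamHat) * s) :=
          mul_le_mul_of_nonneg_right (le_abs_self _) (Real.exp_pos _).le
      _ ≤ |H1 p G r x0| := mul_le_of_le_one_right (abs_nonneg _) hE
  rw [growth]
  gcongr
  exact hdec.2.1.le

theorem growth_mul_le_of_le_horizon {l D c d : ℝ} (hl : 0 < l) (hD : 0 < D) (hc : 0 < c)
    (h : d ≤ 1 / l * Real.log (1 + c / D)) : D * (Real.exp (l * d) - 1) ≤ c := by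
  have h1 : l * d ≤ Real.log (1 + c / D) := by
    rw [one_div_mul_eq_div, le_div_iff₀ hl] at h
    linarith
  rw [Real.le_log_iff_exp_le (by positivity)] at h1
  have h2 : Real.exp (l * d) - 1 ≤ c / D := by linarith
  rw [le_div_iff₀ hD] at h2
  linarith

theorem growth_mul_lt_of_lt_horizon {l D c d : ℝ} (hl : 0 < l) (hD : 0 < D) (hc : 0 < c)
    (h : d < 1 / l * Real.log (1 + c / D)) : D * (Real.exp (l * d) - 1) < c := by
  have h1 : l * d < Real.log (1 + c / D) := by
    rw [one_div_mul_eq_div, lt_div_iff₀ hl] at h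
    linarith
  rw [Real.lt_log_iff_exp_lt (by positivity)] at h1
  have h2 : Real.exp (l * d) - 1 < c / D := by linarith
  rw [lt_div_iff₀ hD] at h2
  linarith

theorem tau_pos (hN : 2 ≤ N) (hdec : IsDecayPair G r p.betaHat p.lamHat)
    (hβ : 0 < p.beta) (hγ : 0 < p.gammaD) (hlam : 0 < p.lam) (hl : p.lam < p.lamHat)
    (x0 : Fin N → EuclideanSpace ℝ (Fin n)) (i : Fin N) {s : ℝ} (hs : 0 ≤ s) :
    0 < tau p G r x0 i s := by
  have hg := growth_pos hN hdec hβ hγ hlam hl x0 i hs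
  rw [tau, horizon_eq]
  have := hdec.2.1
  exact mul_pos (by positivity) (Real.log_pos (lt_add_of_pos_right _ (div_pos hβ hg)))

theorem exists_le_tau (hN : 2 ≤ N) (hdec : IsDecayPair G r p.betaHat p.lamHat)
    (hβ : 0 < p.beta) (hγ : 0 < p.gammaD) (hlam : 0 < p.lam) (hl : p.lam < p.lamHat)
    (x0 : Fin N → EuclideanSpace ℝ (Fin n)) :
    ∃ c, 0 < c ∧ ∀ i s, 0 ≤ s → c ≤ tau p G r x0 i s := by
  have : Nonempty (Fin N) := ⟨r⟩
  have hl0 := hdec.2.1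
  set C : Fin N → ℝ := fun i => H2 p G r i / p.lam + |H1 p G r x0| / p.lamHat with hC
  have hC0 : ∀ i, 0 < C i := fun i =>
    (growth_pos hN hdec hβ hγ hlam hl x0 i le_rfl).trans_le (growth_le hdec hl x0 i le_rfl)
  obtain ⟨i₀, hi₀⟩ := Finite.exists_max C
  refine ⟨1 / p.lamHat * Real.log (1 + p.beta / C i₀),
    mul_pos (by positivity) (Real.log_pos (lt_add_of_pos_right _ (div_pos hβ (hC0 i₀)))),
    fun i s hs => ?_⟩
  have hg := growth_pos hN hdec hβ hγ hlam hl x0 i hs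
  have hgC : growth p G r x0 i s ≤ C i₀ := (growth_le hdec hl x0 i hs).trans (hi₀ i)
  rw [tau, horizon_eq]
  refine mul_le_mul_of_nonneg_left (Real.log_le_log ?_ ?_) (by positivity)
  · have := hC0 i₀
    positivity
  · gcongr

end Constants

/-! ### The bootstrap, absence of accumulation, and consensus -/

namespace Run

variable {N n : ℕ} {R : Run N n} {G : Digraph (Fin N)} {r : Fin N} {p : Params}

/-- At time `s` every agent sees its neighbours with an error below `γ exp (-λ s)`. -/
def Accurate (R : Run N n) (G : Digraph (Fin N)) (p : Params) (s : ℝ) : Prop :=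
  ∀ i j, G.Adj j i → ‖R.seen j i s - R.x j s‖ < p.gamma * Real.exp (-(p.lam * s))

namespace IsExecution

variable (hR : R.IsExecution G p) (hN : 2 ≤ N) (hβ : 0 < p.beta) (hγ : 0 < p.gammaD)
  (hδ : 0 < p.deltaBar) (hdec : IsDecayPair G r p.betaHat p.lamHat) (hlam : 0 < p.lam)
  (hl : p.lam < p.lamHat)

section

include hR

theorem tau0_le (hδ : 0 < p.deltaBar) (i : Fin N) (hτ : p.tau0 ≤ R.t i 1 - R.t i 0 ∨
    p.tau0 ≤ min p.deltaBar (tau p G r R.init i (R.t i 0))) : p.tau0 ≤ p.deltaBar := by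
  rcases hτ with h | h
  · linarith [hR.next_le hδ i 0]
  · exact h.trans (min_le_left _ _)

include hβ

/-- Each neighbour contributes a sampling error bounded by the `β` threshold and a reception error
bounded by accuracy. -/
theorem control_eq {i : Fin N} {s : ℝ} (hs0 : 0 ≤ s) (hs : R.Before s)
    (hacc : R.Accurate G p s) :
    ∃ z, R.control G i s = z - ∑ j ∈ nbrs G i, (R.x i s - R.x j s) ∧
      ‖z‖ ≤ deg G i * ((p.beta + p.gamma) * Real.exp (-(p.lam * s))) := by
  refine ⟨-∑ j ∈ nbrs G i, ((R.x i (R.t i (R.lastEvent i s)) - R.x i s)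
    - (R.seen j i s - R.x j s)), ?_, ?_⟩
  · rw [control, ← neg_add', ← Finset.sum_add_distrib]
    congr 1
    exact Finset.sum_congr rfl fun j _ => by abel
  · rw [norm_neg, deg, ← nsmul_eq_mul]
    refine (norm_sum_le _ _).trans (Finset.sum_le_card_nsmul _ _ _ fun j hj => ?_)
    obtain ⟨h1, h2⟩ := hR.lastEvent_spec (i := i) hs0 hs
    rw [add_mul]
    exact (norm_sub_le _ _).trans (add_le_add (hR.norm_event_sub_le hβ hs h1 h2.le)
      (hacc i j ((mem_nbrs G).1 hj)).le)

end

section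

include hR hβ hγ hdec hl

theorem disagreement_and_control_le {T : ℝ} (hT : R.Before T)
    (hacc : ∀ s ∈ Set.Ico 0 T, R.Accurate G p s) :
    (∀ t ∈ Set.Icc 0 T, √(∑ j : {j : Fin N // j ≠ r}, ‖R.x j t - R.x r t‖ ^ 2) ≤
      p.betaHat * eta0 r R.init * Real.exp (-(p.lamHat * t))
        + p.betaHat * p.Gam G r / (p.lamHat - p.lam)
          * (Real.exp (-(p.lam * t)) - Real.exp (-(p.lamHat * t)))) ∧
    ∀ i, ∀ s ∈ Set.Ico 0 T, ‖R.control G i s‖ ≤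
      H1 p G r R.init * Real.exp (-(p.lamHat * s)) + H2 p G r i * Real.exp (-(p.lam * s)) := by
  have hBefore : ∀ s ∈ Set.Ico 0 T, R.Before s := fun s hs => hT.mono hs.2.le
  have hz : ∀ i s, ∃ z, s ∈ Set.Ico 0 T →
      R.control G i s = z - ∑ j ∈ nbrs G i, (R.x i s - R.x j s) ∧
      ‖z‖ ≤ deg G i * ((p.beta + p.gamma) * Real.exp (-(p.lam * s))) := by
    intro i s
    by_cases hs : s ∈ Set.Ico 0 T
    · obtain ⟨z, h⟩ := hR.control_eq hβ (i := i) hs.1 (hBefore s hs) (hacc s hs)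
      exact ⟨z, fun _ => h⟩
    · exact ⟨0, fun h => absurd h hs⟩
  choose z hz using hz
  have hc : 0 ≤ p.beta + p.gamma := (add_pos hβ (Params.gamma_pos hβ hγ)).le
  have hη : ∀ t ∈ Set.Icc 0 T, _ := fun t ht => sqrt_sum_disagreement_sq_le (x := R.x)
    (u := R.control G) (z := z) hdec hl (hR.continuousOn_Icc hT)
    (fun i s hs => hR.dynamics i s hs.1 (hBefore s hs)) (fun i s hs => (hz i s hs).1) hc
    (fun i s hs => (hz i s hs).2) (Params.disturbance_le_Gam hβ) ht
  refine ⟨hη, fun i s hs => ?_⟩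
  have h1 := hη s ⟨hs.1, hs.2.le⟩
  obtain ⟨h2, h3⟩ := hz i s hs
  have h4 : ‖∑ j ∈ nbrs G i, (R.x i s - R.x j s)‖
      ≤ gainL G r * √(∑ j : {j : Fin N // j ≠ r}, ‖R.x j s - R.x r s‖ ^ 2) := by
    rw [← sum_velocityMatrix_smul G r i fun j => R.x j s]
    exact (norm_sum_smul_le _ _ _).trans
      (mul_le_mul_of_nonneg_right (le_max_right _ _) (Real.sqrt_nonneg _))
  have h5 := mul_le_mul_of_nonneg_left h1 (gainL_nonneg (G := G) (r := r))
  rw [h2]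
  refine (norm_sub_le _ _).trans ((add_le_add h3 (h4.trans h5)).trans (le_of_eq ?_))
  rw [H1, H2]
  unfold init
  ring

include hlam

/-- Integrating the speed bound over `[s, t]`; the factor `exp (-λ t)` is extracted for comparison
with the thresholds at time `t`. -/
theorem norm_sub_le_travel {T : ℝ} (hT : R.Before T)
    (hacc : ∀ s ∈ Set.Ico 0 T, R.Accurate G p s) (i : Fin N) {s t : ℝ} (hs : 0 ≤ s) (hst : s ≤ t)
    (htT : t ≤ T) :
    ‖R.x i s - R.x i t‖ ≤ Real.exp (-(p.lam * t)) *
      (H2 p G r i / p.lam * (Real.exp (p.lam * (t - s)) - 1)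
        + H1 p G r R.init * Real.exp ((p.lam - p.lamHat) * s) / p.lamHat *
          (Real.exp (p.lam * (t - s))
            - Real.exp (p.lam * (t - s)) / Real.exp (p.lamHat * (t - s)))) := by
  have hl0 := hdec.2.1
  have hcont : ContinuousOn (fun v => R.x i v - R.x i s) (Set.Icc s t) :=
    ((hR.continuousOn_Icc hT i).mono (Set.Icc_subset_Icc hs htT)).sub continuousOn_const
  set B : ℝ → ℝ := fun v => H1 p G r R.init / p.lamHat
      * (Real.exp (-(p.lamHat * s)) - Real.exp (-(p.lamHat * v)))
    + H2 p G r i / p.lam * (Real.exp (-(p.lam * s)) - Real.exp (-(p.lam * v))) with hB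
  have hBd : ∀ v, HasDerivAt B (H1 p G r R.init * Real.exp (-(p.lamHat * v))
      + H2 p G r i * Real.exp (-(p.lam * v))) v := by
    intro v
    have h1 := ((((hasDerivAt_id v).const_mul p.lamHat).neg.exp).const_sub
      (Real.exp (-(p.lamHat * s)))).const_mul (H1 p G r R.init / p.lamHat)
    have h2 := ((((hasDerivAt_id v).const_mul p.lam).neg.exp).const_sub
      (Real.exp (-(p.lam * s)))).const_mul (H2 p G r i / p.lam)
    refine (h1.add h2).congr_deriv ?_
    simp only [id, Pi.neg_apply]
    field_simp
  have hmain := image_norm_le_of_norm_deriv_right_le_deriv_boundary hcont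
    (fun v hv => (hR.dynamics i v (hs.trans hv.1)
      (hT.mono (hv.2.le.trans htT))).sub_const (R.x i s)) (B := B) (by simp [hB]) hBd
    (fun v hv => (hR.disagreement_and_control_le hβ hγ hdec hl hT hacc).2 i v
      ⟨hs.trans hv.1, hv.2.trans_le htT⟩) (Set.right_mem_Icc.2 hst)
  rw [norm_sub_rev]
  refine hmain.trans (le_of_eq ?_)
  have e1 : Real.exp (-(p.lam * s)) = Real.exp (-(p.lam * t)) * Real.exp (p.lam * (t - s)) := by
    rw [← Real.exp_add]
    ring_nf
  have e2 : Real.exp (-(p.lamHat * s)) = Real.exp (-(p.lam * t)) *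
      Real.exp ((p.lam - p.lamHat) * s) * Real.exp (p.lam * (t - s)) := by
    rw [← Real.exp_add, ← Real.exp_add]
    ring_nf
  have e3 : Real.exp (-(p.lamHat * t)) = Real.exp (-(p.lam * t)) *
      Real.exp ((p.lam - p.lamHat) * s) *
        (Real.exp (p.lam * (t - s)) / Real.exp (p.lamHat * (t - s))) := by
    rw [← Real.exp_add, ← Real.exp_sub, ← Real.exp_add]
    ring_nf
  simp only [hB]
  rw [e1, e2, e3]
  ring

include hN

/-- An event not caused by `δ̄` needs travel equal to `β exp (-λ t)`. For a gap shorter than `τ`,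
`travel_slack` keeps the travel strictly below this. -/
theorem min_tau_le {T : ℝ} (hT : R.Before T) (hacc : ∀ s ∈ Set.Ico 0 T, R.Accurate G p s)
    (i : Fin N) (k : ℕ) (hk : R.t i (k + 1) ≤ T) :
    min p.deltaBar (tau p G r R.init i (R.t i k)) ≤ R.t i (k + 1) - R.t i k := by
  rcases (hR.next_event i k).1.2 with h | h
  swap
  · rw [h, add_sub_cancel_left]
    exact min_le_left _ _
  by_contra! hlt
  have ht0 := hR.t_nonneg i k
  have hd : R.t i (k + 1) - R.t i k < tau p G r R.init i (R.t i k) := hlt.trans_le (min_le_right _ _)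
  have hd0 : 0 < R.t i (k + 1) - R.t i k := sub_pos.2 (hR.lt_next i k)
  rw [tau, horizon_eq] at hd
  have h1 := growth_mul_lt_of_lt_horizon hdec.2.1
    (growth_pos hN hdec hβ hγ hlam hl R.init i ht0) hβ hd
  have h2 := hR.norm_sub_le_travel hβ hγ hdec hlam hl hT hacc i ht0 (hR.lt_next i k).le hk
  set d := R.t i (k + 1) - R.t i k
  have ha : 1 ≤ Real.exp (p.lam * d) := Real.one_le_exp (by positivity)
  have hab : Real.exp (p.lam * d) ≤ Real.exp (p.lamHat * d) := by gcongr
  have h3 := travel_slack hlam hl (steadyGain_le_H2 hβ hγ i)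
    (neg_steadyGain_le hN hdec hβ hγ hlam hl R.init ht0) ha hab
  have hP := steadyGain_pos hN hdec hβ hγ hlam hl
  have h4 : 0 ≤ steadyGain p G r / p.lam - steadyGain p G r / p.lamHat
      + steadyGain p G r / (p.lamHat * Real.exp (p.lamHat * d)) := by
    have : steadyGain p G r / p.lamHat ≤ steadyGain p G r / p.lam :=
      div_le_div_of_nonneg_left hP.le hlam hl.le
    have := hdec.2.1
    have : 0 ≤ steadyGain p G r / (p.lamHat * Real.exp (p.lamHat * d)) := by positivity
    linarith
  have h5 := mul_nonneg (sub_nonneg.2 hab) h4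
  rw [h, mul_comm p.beta] at h2
  have h6 := le_of_mul_le_mul_left h2 (Real.exp_pos _)
  rw [growth] at h1
  linarith

variable (hτ : ∀ i k, p.tau0 ≤ R.t i (k + 1) - R.t i k ∨
    p.tau0 ≤ min p.deltaBar (tau p G r R.init i (R.t i k)))

include hτ

theorem add_tau0_le {T : ℝ} (hT : R.Before T) (hacc : ∀ s ∈ Set.Ico 0 T, R.Accurate G p s)
    (i : Fin N) (m μ : ℕ) (hm : R.t i (m + μ) ≤ T) :
    R.t i m + μ * p.tau0 ≤ R.t i (m + μ) := by
  induction μ with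
  | zero => simp
  | succ μ ih =>
    have h1 := ih ((hR.lt_next i (m + μ)).le.trans hm)
    have h2 : p.tau0 ≤ R.t i (m + μ + 1) - R.t i (m + μ) :=
      (hτ i (m + μ)).elim id fun h =>
        h.trans (hR.min_tau_le hN hβ hγ hdec hlam hl hT hacc i (m + μ) hm)
    rw [← add_assoc]
    push_cast
    linarith

variable (hdelay : ∀ i j, G.Adj i j → ∀ k, R.recv i j k →
    R.delay i j k ≤ delayBound p G r R.init i (R.t i k))

include hδ hdelay

theorem accurate_of_accurate_before {T : ℝ} (hT0 : 0 ≤ T) (hT : R.Before T)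
    (hacc : ∀ s ∈ Set.Ico 0 T, R.Accurate G p s) : R.Accurate G p T := by
  intro i j hji
  obtain ⟨hm, q, hq1, hqρ, hrecv, hpend⟩ := hR.lastRecv_spec hji hT0 hT
  rw [seen]
  set m := R.lastRecv j i T
  have hτδ := hR.tau0_le hδ j (hτ j 0)
  have hstep := hR.add_tau0_le hN hβ hγ hdec hlam hl hτ hT hacc j m
  have hup := hR.t_add_le hδ j m q
  have hqδ : (q : ℝ) * p.deltaBar ≤ p.rho * p.deltaBar := by gcongr
  rcases lt_or_ge T (R.t j (m + q)) with hlt | hge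
  · obtain ⟨q', hq', h1, h2⟩ : ∃ q', q' < q ∧ R.t j (m + q') ≤ T ∧ T < R.t j (m + q' + 1) := by
      obtain ⟨h1, h2⟩ := hR.lastEvent_spec (i := j) hT0 hT
      have h3 := (hR.strictMono_t j).lt_iff_lt.1 (h1.trans_lt hlt)
      have h4 := (hR.strictMono_t j).lt_iff_lt.1 (hm.trans_lt h2)
      refine ⟨R.lastEvent j T - m, by omega, ?_, ?_⟩
      · rwa [Nat.add_sub_cancel' (by omega)]
      · rwa [Nat.add_sub_cancel' (by omega)]
    -- No newer undropped broadcast `m + q` has been sent yet. The last, unfinished interval is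
    -- measured against the threshold at `T` itself.
    set σ : ℕ → ℝ := fun μ => if μ ≤ q' then R.t j (m + μ) else T with hσ
    have hsum : ‖R.x j (R.t j m) - R.x j T‖
        ≤ ∑ μ ∈ Finset.Icc 1 (q' + 1), p.beta * Real.exp (-(p.lam * σ μ)) := by
      rw [Finset.sum_Icc_succ_top (by omega)]
      refine (norm_sub_le_norm_sub_add_norm_sub _ (R.x j (R.t j (m + q'))) _).trans ?_
      refine add_le_add ?_ ?_
      · refine (hR.norm_event_sub_event_le hβ j m q' (hT.mono h1)).trans (le_of_eq ?_)
        refine Finset.sum_congr rfl fun μ hμ => ?_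
        simp only [hσ, if_pos (Finset.mem_Icc.1 hμ).2]
      · simp only [hσ, if_neg (Nat.not_succ_le_self q')]
        exact hR.norm_event_sub_le hβ hT h1 h2.le
    refine (hsum.trans (Params.sum_exp_le_gammaL (s := T) hβ hlam (by omega) fun μ hμ => ?_)).trans_lt
      ?_
    · obtain ⟨hμ1, hμ2⟩ := Finset.mem_Icc.1 hμ
      by_cases h : μ ≤ q'
      · simp only [hσ, if_pos h]
        have := hstep μ (((hR.strictMono_t j).monotone (by omega)).trans h1)
        linarith
      · simp only [hσ, if_neg h, sub_self]
        have hμρ : (μ : ℝ) ≤ p.rho := by exact_mod_cast (by omega : μ ≤ p.rho)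
        have e1 : (μ : ℝ) * p.tau0 ≤ μ * p.deltaBar := by gcongr
        have e2 : (μ : ℝ) * p.deltaBar ≤ p.rho * p.deltaBar := by gcongr
        linarith
    · exact mul_lt_mul_of_pos_right (lt_add_of_pos_right _ hγ) (Real.exp_pos _)
  -- The undropped broadcast `m + q` is still in flight. The error is the accumulation up to its
  -- sending time plus the travel since then, which lasts less than the admissible delay.
  · have ht0 := hR.t_nonneg j (m + q)
    set s := R.t j (m + q) with hs
    have h1 : ‖R.x j (R.t j m) - R.x j s‖ ≤ p.gammaL * Real.exp (-(p.lam * s)) := by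
      refine (hR.norm_event_sub_event_le hβ j m q (hT.mono hge)).trans
        (Params.sum_exp_le_gammaL hβ hlam hqρ fun μ hμ => ?_)
      have := hstep μ (((hR.strictMono_t j).monotone
        (Nat.add_le_add_left (Finset.mem_Icc.1 hμ).2 m)).trans hge)
      linarith
    have h2 := hR.norm_sub_le_travel hβ hγ hdec hlam hl hT hacc j ht0 hge le_rfl
    have hd : T - s ≤ delayBound p G r R.init j s := by
      have := hdelay j i hji (m + q) hrecv
      linarith
    rw [delayBound, horizon_eq] at hd
    have h3 := growth_mul_le_of_le_horizon hdec.2.1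
      (growth_pos hN hdec hβ hγ hlam hl R.init j ht0) hγ hd
    have h4 := travel_strict hlam hl (steadyGain_le_H2 hβ hγ j)
      (neg_steadyGain_le hN hdec hβ hγ hlam hl R.init ht0) (sub_nonneg.2 hge)
      (Params.gammaL_nonneg hβ) hγ (lam_mul_gamma_le_steadyGain hN hdec hβ hγ hl) h3
    have e : Real.exp (-(p.lam * s)) = Real.exp (-(p.lam * T)) * Real.exp (p.lam * (T - s)) := by
      rw [← Real.exp_add]
      ring_nf
    rw [e] at h1
    have h5 := mul_lt_mul_of_pos_left h4 (Real.exp_pos (-(p.lam * T)))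
    have h6 := norm_sub_le_norm_sub_add_norm_sub (R.x j (R.t j m)) (R.x j s) (R.x j T)
    rw [Params.gamma]
    linarith

/-- Accuracy propagates to all times before an accumulation of events. -/
theorem accurate {T : ℝ} (hT0 : 0 ≤ T) (hT : R.Before T) : R.Accurate G p T := by
  by_contra hbad
  set S := {s | 0 ≤ s ∧ R.Before s ∧ ¬ R.Accurate G p s} with hS
  have hne : S.Nonempty := ⟨T, hT0, hT, hbad⟩
  have hbdd : BddBelow S := ⟨0, fun s hs => hs.1⟩
  set a := sInf S with ha
  have ha0 : 0 ≤ a := le_csInf hne fun s hs => hs.1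
  have haT : R.Before a := hT.mono (csInf_le hbdd ⟨hT0, hT, hbad⟩)
  -- Accuracy holds before the infimum of bad times, hence at it. For `a = 0` the interval before is
  -- empty, so no separate base case is needed.
  have hacc : R.Accurate G p a :=
    hR.accurate_of_accurate_before hN hβ hγ hδ hdec hlam hl hτ hdelay ha0 haT fun s hs => by
      by_contra h
      exact hs.2.not_ge (csInf_le hbdd ⟨hs.1, haT.mono hs.2.le, h⟩)
  have hev : ∀ᶠ u in 𝓝[≥] a, R.Accurate G p u := by
    simp only [Accurate, eventually_all]
    intro i j hji
    have hx : ContinuousWithinAt (R.x j) (Set.Ici a) a := (hR.dynamics j a ha0 haT).continuousWithinAt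
    have hcont : ContinuousWithinAt (fun u => ‖R.seen j i a - R.x j u‖
        - p.gamma * Real.exp (-(p.lam * u))) (Set.Ici a) a :=
      ((continuousWithinAt_const.sub hx).norm).sub
        (Continuous.continuousWithinAt (by fun_prop))
    filter_upwards [hR.lastRecv_eventually_eq hji haT,
      hcont.eventually_lt_const (sub_neg.2 (hacc i j hji))] with u hu1 hu2
    rw [seen, hu1]
    exact sub_neg.1 hu2
  obtain ⟨b, hb, hb'⟩ := (mem_nhdsGE_iff_exists_Ico_subset).1 hev
  obtain ⟨s, hs, hsb⟩ := exists_lt_of_csInf_lt hne hb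
  exact hs.2.2 (hb' ⟨csInf_le hbdd hs, hsb⟩)

/-- No agent accumulates events, since the first accumulation would violate the lower bound on
the inter-event times. -/
theorem before (s : ℝ) : R.Before s := by
  obtain ⟨c, hc, hcτ⟩ := exists_le_tau hN hdec hβ hγ hlam hl R.init
  by_contra hs
  set F := {i : Fin N | BddAbove (Set.range (R.t i))} with hF
  obtain ⟨i₀, hi₀⟩ : F.Nonempty := by
    simp only [Before, not_forall, not_exists, not_lt] at hs
    obtain ⟨i, hi⟩ := hs
    exact ⟨i, s, by rintro _ ⟨k, rfl⟩; exact hi k⟩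
  -- The agent whose events accumulate first: each of its events lies strictly before every
  -- accumulation point, so the gap bound applies to all of them.
  obtain ⟨i, hi, hmin⟩ := Set.exists_min_image F (fun i => ⨆ k, R.t i k) (Set.toFinite F) ⟨i₀, hi₀⟩
  have hbefore : ∀ k, R.Before (R.t i k) := by
    intro k j
    by_cases hj : j ∈ F
    · refine exists_lt_of_lt_ciSup (lt_of_lt_of_le ?_ (hmin j hj))
      exact (hR.lt_next i k).trans_le (le_ciSup hi (k + 1))
    · by_contra! h
      exact hj ⟨R.t i k, by rintro _ ⟨l, rfl⟩; exact h l⟩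
  have hgap : ∀ k, min p.deltaBar c ≤ R.t i (k + 1) - R.t i k := fun k =>
    (min_le_min_left _ (hcτ i _ (hR.t_nonneg i k))).trans
      (hR.min_tau_le hN hβ hγ hdec hlam hl (hbefore (k + 1)) (fun u hu =>
        hR.accurate hN hβ hγ hδ hdec hlam hl hτ hdelay hu.1 ((hbefore (k + 1)).mono hu.2.le))
        i k le_rfl)
  have hlin : ∀ k : ℕ, k * min p.deltaBar c ≤ R.t i k := by
    intro k
    induction k with
    | zero => simpa using hR.t_nonneg i 0
    | succ k ih =>
      push_cast
      linarith [hgap k]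
  obtain ⟨B, hB⟩ := hi
  obtain ⟨k, hk⟩ := exists_nat_gt (B / min p.deltaBar c)
  rw [div_lt_iff₀ (lt_min hδ hc)] at hk
  linarith [hlin k, hB ⟨k, rfl⟩]

theorem min_tau_le_interevent (i : Fin N) (k : ℕ) :
    min p.deltaBar (tau p G r R.init i (R.t i k)) ≤ R.t i (k + 1) - R.t i k :=
  have hb := hR.before hN hβ hγ hδ hdec hlam hl hτ hdelay
  hR.min_tau_le hN hβ hγ hdec hlam hl (hb (R.t i (k + 1)))
    (fun u hu => hR.accurate hN hβ hγ hδ hdec hlam hl hτ hdelay hu.1 (hb u)) i k le_rfl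

theorem noZeno : R.NoZeno := by
  intro i
  refine tendsto_atTop.2 fun B => ?_
  obtain ⟨k, hk⟩ := hR.before hN hβ hγ hδ hdec hlam hl hτ hdelay B i
  exact eventually_atTop.2 ⟨k, fun m hm => hk.le.trans ((hR.strictMono_t i).monotone hm)⟩

theorem consensus : R.Consensus := by
  have hb := hR.before hN hβ hγ hδ hdec hlam hl hτ hdelay
  have hbound : ∀ t : ℝ, 0 ≤ t → _ := fun t ht =>
    (hR.disagreement_and_control_le hβ hγ hdec hl (hb t) fun u hu =>
      hR.accurate hN hβ hγ hδ hdec hlam hl hτ hdelay hu.1 (hb u)).1 t ⟨ht, le_rfl⟩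
  have hexp : ∀ a : ℝ, 0 < a → Tendsto (fun t => Real.exp (-(a * t))) atTop (𝓝 0) := fun a ha =>
    Real.tendsto_exp_atBot.comp (tendsto_neg_atTop_atBot.comp (tendsto_id.const_mul_atTop ha))
  have hlim : Tendsto (fun t => √(∑ j : {j : Fin N // j ≠ r}, ‖R.x j t - R.x r t‖ ^ 2)) atTop
      (𝓝 0) := by
    refine squeeze_zero' (Eventually.of_forall fun _ => Real.sqrt_nonneg _)
      ((eventually_ge_atTop 0).mono hbound) ?_
    have h := ((hexp p.lamHat hdec.2.1).const_mul (p.betaHat * eta0 r R.init)).add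
      (((hexp p.lam hlam).sub (hexp p.lamHat hdec.2.1)).const_mul
        (p.betaHat * p.Gam G r / (p.lamHat - p.lam)))
    simpa using h
  have hroot : ∀ i, Tendsto (fun t => ‖R.x i t - R.x r t‖) atTop (𝓝 0) := by
    intro i
    by_cases hi : i = r
    · simp [hi]
    · refine squeeze_zero (fun _ => norm_nonneg _) (fun t => ?_) hlim
      refine Real.le_sqrt_of_sq_le ?_
      exact Finset.single_le_sum (f := fun j : {j : Fin N // j ≠ r} => ‖R.x j t - R.x r t‖ ^ 2)
        (a := ⟨i, hi⟩) (fun _ _ => sq_nonneg _) (Finset.mem_univ _)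
  intro i j
  have hsum : Tendsto (fun t => ‖R.x i t - R.x r t‖ + ‖R.x j t - R.x r t‖) atTop (𝓝 0) := by
    simpa using (hroot i).add (hroot j)
  refine squeeze_zero (fun _ => norm_nonneg _) (fun t => ?_) hsum
  rw [norm_sub_rev (R.x j t)]
  exact norm_sub_le_norm_sub_add_norm_sub _ _ _

end

end IsExecution

end Run

end EventConsensus

theorem theorem1 {N n : ℕ} (hN : 2 ≤ N) (G : Digraph (Fin N)) (r : Fin N)
    (hr : EventConsensus.IsRoot G r) :
    (∃ b l : ℝ, EventConsensus.IsDecayPair G r b l) ∧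
    ∀ p : EventConsensus.Params,
      0 < p.beta → 0 < p.gammaD → 0 < p.deltaBar → 1 < p.rho →
      EventConsensus.IsDecayPair G r p.betaHat p.lamHat →
      0 < p.lam → p.lam < p.lamHat → 0 ≤ p.tau0 →
    ∀ R : EventConsensus.Run N n, R.IsExecution G p →
      (∀ i k, p.tau0 ≤ R.t i (k + 1) - R.t i k ∨
        p.tau0 ≤ min p.deltaBar (EventConsensus.tau p G r R.init i (R.t i k))) →
      (∀ i j, G.Adj i j → ∀ k, R.recv i j k →
        R.delay i j k ≤ EventConsensus.delayBound p G r R.init i (R.t i k)) →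
      R.Consensus ∧
      R.NoZeno ∧
      (∀ i k, 0 < EventConsensus.tau p G r R.init i (R.t i k) ∧
        min p.deltaBar (EventConsensus.tau p G r R.init i (R.t i k))
          ≤ R.t i (k + 1) - R.t i k) ∧
      (∃ c : ℝ, 0 < c ∧ ∀ i k, c ≤ R.t i (k + 1) - R.t i k) := by
  refine ⟨EventConsensus.exists_isDecayPair hr, ?_⟩
  intro p hβ hγ hδ _ hdec hlam hl _ R hR hτ hdelay
  have hgap := hR.min_tau_le_interevent hN hβ hγ hδ hdec hlam hl hτ hdelay
  obtain ⟨c, hc, hcτ⟩ := EventConsensus.exists_le_tau hN hdec hβ hγ hlam hl R.init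
  refine ⟨hR.consensus hN hβ hγ hδ hdec hlam hl hτ hdelay,
    hR.noZeno hN hβ hγ hδ hdec hlam hl hτ hdelay,
    fun i k => ⟨EventConsensus.tau_pos hN hdec hβ hγ hlam hl R.init i (hR.t_nonneg i k), hgap i k⟩,
    min p.deltaBar c, lt_min hδ hc, fun i k => ?_⟩
  exact (min_le_min_left _ (hcτ i _ (hR.t_nonneg i k))).trans (hgap i k)
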